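/- **Setting.** Let $(X,d)$ be a complete separable metric space and let $M$ be the set of finite Borel measures on $X$. For $q>0$ let $M_q$ be the set of $\mu\in M$ with $\mu(X)=1$ and $\int d^q(x,a)\,d\mu(x)<\infty$ for some $a\in X$. For $\mu,\nu\in M$ put $$l_q(\mu,\nu)=\inf\Big\{\Big(\int d^q(x,y)\,d\pi(x,y)\Big)^{\frac1q\wedge 1}\ :\ \pi \text{ has marginals } \mu,\nu\Big\}\in[0,\infty].$$ A scaling law is a tuple $\mathbf S=(p_1,S_1,\dots,p_N,S_N)$ of positive reals $p_i$ and Lipschitz maps $S_i:X\to X$; $r_i$ is the Lipschitz constant of $S_i$. A random scaling law is a random variable with values in scaling laws (all $p_i$ and all $S_i(x)$, $x \in X$, are random variables); let $\mathcal S$ be its distribution. A random measure is a random variable with values in $M$. For a probability distribution $\mathcal D$ on $M$, $\mathcal S\mathcal D$ is the distribution of $\sum_i p_iS_i\mu^{(i)}$, where $(p_1,S_1,\dots,p_N,S_N)\sim\mathcal S$, $\mu^{(i)}\sim\mathcal D$ are independent and $S_i\mu^{(i)}$ is the push-forward; a random measure with distribution $\mathcal D$ satisfies $\mathbf S$ if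 $\mathcal S\mathcal D=\mathcal D$. Let $(\tilde\Omega,P)$ be the space of construction trees: $\omega\in\tilde\Omega$ assigns to each finite word $\sigma$ over $\{1,\dots,N\}$ a scaling law $\omega(\sigma)$, and under $P$ the $\omega(\sigma)$ are independent with distribution $\mathcal S$. Write $\omega^{(i)}(\sigma)=\omega(i\sigma)$ and, for a random measure $\mu$ on $\tilde\Omega$, $$(\mathbf S\mu)(\omega)=\sum_{i=1}^N p_i\,S_i\,\mu(\omega^{(i)}),\qquad (p_1,S_1,\dots,p_N,S_N)=\omega(\emptyset).$$ **Theorem.** Suppose $\sum_{i=1}^N p_i=1$ a.s. and $\lambda_q:=\operatorname{ess\,sup}\sum_{i=1}^N p_ir_i^q<1$ for some $q>0$. Suppose that there are a random measure $\alpha$ on $\tilde\Omega$ with $\alpha\in M_q$ a.s. (for instance a constant $\alpha\in M_q$) and a number $\gamma>0$ with $$P\big(l_q(\alpha,\mathbf S\alpha)\ge t\big)\le\frac{\gamma}{t}\qquad\text{for all } t>0 .$$ Then there is a random measure $\mu^*$ on $\tilde\Omega$, with $\mu^*\in M_{q\wedge1}$ a.s., such that: 1. $\mathbf S\mu^*=\mu^*$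 a.s. 2. The iterates converge to $\mu^*$ exponentially fast: let $\mu_0$ be a random measure on $\tilde\Omega$ with $\mu_0\in M_q$ a.s. such that, for some $\gamma'>0$, $P(l_q(\alpha,\mu_0)\ge t)\le\gamma'/t$ for all $t>0$ (if $\alpha$ is constant, every nonrandom $\mu_0\in M_q$ qualifies), and let $\lambda_q^{\frac1q\wedge1}<\rho<1$. Then there is a constant $C$ with $$P\big(l_{q\wedge1}(\mathbf S^n\mu_0,\mu^*)\ge t\big)\le \frac{C\rho^n}{t}\qquad\text{for all } n\ge0,\ t>0,$$ and almost surely there is a finite $C(\omega)$ with $l_{q\wedge1}\big((\mathbf S^n\mu_0)(\omega),\mu^*(\omega)\big)\le C(\omega)\rho^n$ for all $n\ge0$. 3. Up to probability distribution, $\mu^*$ is the unique unit mass random measure which satisfies $\mathbf S$: a probability distribution $\mathcal D$ on $M$ concentrated on measures of mass $1$ satisfies $\mathcal S\mathcal D=\mathcal D$ if and only if $\mathcal D$ is the distribution of $\mu^*$. -/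

import Mathlib

open MeasureTheory
open scoped ENNReal NNReal

noncomputable section

namespace RandomFractal

/-- A tuple `(p₁, S₁, …, p_N, S_N)` of positive real weights and Lipschitz self-maps of `X`.
That the weights sum to `1` is stated separately (as an almost sure property). -/
structure ScalingLaw (N : ℕ) (X : Type*) [PseudoEMetricSpace X] where
  weight : Fin N → ℝ≥0
  map : Fin N → X → X
  weight_pos : ∀ i, 0 < weight i
  lipschitz : ∀ i, ∃ K : ℝ≥0, LipschitzWith K (map i)

/-- The σ-algebra on scaling laws generated by the weights `p_i` and the evaluations `S_i x`:
a map into `ScalingLaw N X` is measurable iff all `p_i` and all `S_i x` are measurable. -/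
instance instMeasurableSpaceScalingLaw {N : ℕ} {X : Type*} [PseudoEMetricSpace X]
    [MeasurableSpace X] : MeasurableSpace (ScalingLaw N X) :=
  (⨆ i : Fin N, MeasurableSpace.comap (fun s : ScalingLaw N X => s.weight i) inferInstance) ⊔
    (⨆ i : Fin N, ⨆ x : X,
      MeasurableSpace.comap (fun s : ScalingLaw N X => s.map i x) inferInstance)

/-- The best Lipschitz constant of a map (`∞` if the map is not Lipschitz). -/
def lipConst {X : Type*} [PseudoEMetricSpace X] (f : X → X) : ℝ≥0∞ :=
  ⨅ (K : ℝ≥0) (_ : LipschitzWith K f), (K : ℝ≥0∞)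

/-- `λ_q = ess sup ∑ i, p_i r_i ^ q`, where `r_i` is the Lipschitz constant of `S_i` and the
random scaling law has distribution `𝒮`. -/
def lamSup {N : ℕ} {X : Type*} [PseudoEMetricSpace X] [MeasurableSpace X]
    (q : ℝ) (𝒮 : Measure (ScalingLaw N X)) : ℝ≥0∞ :=
  essSup (fun s : ScalingLaw N X => ∑ i, (s.weight i : ℝ≥0∞) * lipConst (s.map i) ^ q) 𝒮

/-- `M_q`: the unit mass Borel measures on `X` with finite `q`-th moment. -/
def Mq (X : Type*) [PseudoEMetricSpace X] [MeasurableSpace X] (q : ℝ) :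
    Set (FiniteMeasure X) :=
  {μ | μ.mass = 1 ∧ ∃ a : X, ∫⁻ x, edist x a ^ q ∂(μ : Measure X) < ∞}

/-- The minimal metric `l_q(μ, ν) = inf (∫ d(x,y)^q dπ(x,y)) ^ (1/q ∧ 1)`, the infimum being over
all measures `π` on `X × X` with marginals `μ` and `ν`; it takes values in `[0, ∞]`. -/
def minimalMetric {X : Type*} [PseudoEMetricSpace X] [MeasurableSpace X] (q : ℝ)
    (μ ν : FiniteMeasure X) : ℝ≥0∞ :=
  ⨅ (π : Measure (X × X))
    (_ : π.map Prod.fst = (μ : Measure X) ∧ π.map Prod.snd = (ν : Measure X)),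
    (∫⁻ z, edist z.1 z.2 ^ q ∂π) ^ min (1 / q) 1

/-- `∑ i, p_i S_i m_i`, where `S_i m_i` is the push-forward of `m_i` under `S_i`. -/
def ScalingLaw.combine {N : ℕ} {X : Type*} [PseudoEMetricSpace X] [MeasurableSpace X]
    (s : ScalingLaw N X) (m : Fin N → FiniteMeasure X) : FiniteMeasure X :=
  ∑ i, s.weight i • (m i).map (s.map i)

/-- The operator `𝒟 ↦ 𝒮𝒟` on distributions of random measures: the law of `∑ i, p_i S_i μ⁽ⁱ⁾`
where the scaling law has distribution `𝒮`, each `μ⁽ⁱ⁾` has distribution `𝒟`, and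
the scaling law and `μ⁽¹⁾, …, μ⁽ᴺ⁾` are independent. -/
def distApply {N : ℕ} {X : Type*} [PseudoEMetricSpace X] [MeasurableSpace X]
    (𝒮 : Measure (ScalingLaw N X)) (𝒟 : Measure (FiniteMeasure X)) :
    Measure (FiniteMeasure X) :=
  (𝒮.prod (Measure.pi fun _ : Fin N => 𝒟)).map fun z => z.1.combine z.2

/-- Construction trees: a scaling law at every node of the `N`-ary tree, the nodes being the
finite words over `{1, …, N}`. -/
abbrev ConstructionTree (N : ℕ) (X : Type*) [PseudoEMetricSpace X] : Type _ :=
  List (Fin N) → ScalingLaw N X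

/-- The probability measure on construction trees under which the scaling laws at the nodes are
independent with distribution `𝒮`. -/
def treeMeasure {N : ℕ} {X : Type*} [PseudoEMetricSpace X] [MeasurableSpace X]
    (𝒮 : Measure (ScalingLaw N X)) : Measure (ConstructionTree N X) :=
  Measure.infinitePi fun _ : List (Fin N) => 𝒮

instance {N : ℕ} {X : Type*} [PseudoEMetricSpace X] [MeasurableSpace X]
    (𝒮 : Measure (ScalingLaw N X)) [IsProbabilityMeasure 𝒮] :
    IsProbabilityMeasure (treeMeasure 𝒮) := by
  unfold treeMeasure; infer_instance

/-- The subtree `ω⁽ⁱ⁾` of the construction tree `ω` above the first-level node `i`. -/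
def subtree {N : ℕ} {X : Type*} [PseudoEMetricSpace X] (ω : ConstructionTree N X) (i : Fin N) :
    ConstructionTree N X :=
  fun σ => ω (i :: σ)

/-- The action `(𝐒μ)(ω) = ∑ i, p_i(ω) S_i(ω) μ(ω⁽ⁱ⁾)` of the random scaling law on random
measures over the space of construction trees; `p_i(ω), S_i(ω)` are read off at the root. The
scaling law at the root and the `μ(ω⁽ⁱ⁾)` are independent, and each `μ(ω⁽ⁱ⁾)` is distributed
as `μ`. On a constant `μ₀`, the `n`-th iterate is
`∑ p_i p_j^i p_k^{ij} ⋯ S_i ∘ S_j^i ∘ S_k^{ij} ∘ ⋯ μ₀`. -/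
def treeApply {N : ℕ} {X : Type*} [PseudoEMetricSpace X] [MeasurableSpace X]
    (μ : ConstructionTree N X → FiniteMeasure X) : ConstructionTree N X → FiniteMeasure X :=
  fun ω => (ω []).combine fun i => μ (subtree ω i)

/-- `P(f ≥ t) ≤ γ / t` for all `t > 0`, for some constant `γ > 0`. -/
def HasWeakTail {Ω : Type*} [MeasurableSpace Ω] (P : Measure Ω) (f : Ω → ℝ≥0∞) : Prop :=
  ∃ γ : ℝ, 0 < γ ∧ ∀ t : ℝ, 0 < t → P {ω | ENNReal.ofReal t ≤ f ω} ≤ ENNReal.ofReal (γ / t)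

end RandomFractal

end

open RandomFractal

/-! Everything is reduced to exponents at most one. Hölder gives `minimalMetric (min q 1) ≤
minimalMetric q` on unit masses, and the power mean inequality bounds the contraction sum for `min q
1` by `λ_q ^ min (1/q) 1`. For `q ≤ 1` the function `d ^ q` is itself a metric, so the minimal
metric satisfies the triangle inequality and behaves like a Wasserstein-1 distance.

Pushing couplings forward along the branches gives the pathwise contraction
`minimalMetric_combine_le`: the distance of `𝐒μ` and `𝐒ν` at `ω` is at most the sum of `p_i r_i ^ q`
times the distances at the subtrees. After `n` steps this is a sum over `N ^ n` nodes with weights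
of total mass at most `λ ^ n`. The hypothesis is only a weak `L¹` bound, which is not a norm, so
such a sum cannot be estimated term by term. Truncating at height `t` and cutting the truncation
into dyadic layers makes expectations available, at the price of one factor per layer; linearly many
layers in `n` suffice (`weakTail_branchSum`). The resulting bound of order `n λ ^ n / t` is
geometric at any rate `κ > λ`.

Hence the distances between consecutive iterates of `α` are almost surely summable. The minimal
metric is complete on unit masses (`exists_limit_minimalMetric`): near-optimal couplings are glued
into one random sequence in `X`, which converges almost surely. This produces `μ*`, its invariance
and the rates (`exists_fixedPoint`).

Uniqueness assumes no moments of the competing law `𝒟`. Couple `𝒟` with the law of `α` independently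
and apply the scaling law to both with shared maps. The mean difference of integrals of a bounded
Lipschitz function is then controlled by a truncated cost `∫ min B (λ ^ n u d(x,a) ^ q) dζ` with `ζ`
finite, which tends to zero by dominated convergence. Characteristic functions of such integrals
determine the law (`ext_of_integral_exp`). -/

namespace RandomFractal

/-! ### Measurability in the space of finite measures. -/

section FiniteMeasure

variable {X : Type*} [MeasurableSpace X]

theorem measurable_finiteMeasure_iff {Ω : Type*} [MeasurableSpace Ω] {f : Ω → FiniteMeasure X} :
    Measurable f ↔ ∀ A, MeasurableSet A → Measurable fun ω => (f ω : Measure X) A := by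
  refine ⟨fun h A hA => (Measure.measurable_coe hA).comp (measurable_subtype_coe.comp h),
    fun h => ?_⟩
  exact Measurable.subtype_mk (f := fun ω => (f ω : Measure X))
    (Measure.measurable_of_measurable_coe _ h)

theorem measurable_integral_finiteMeasure {f : X → ℝ} (hf : Measurable f) {C : ℝ}
    (hC : ∀ x, |f x| ≤ C) : Measurable fun m : FiniteMeasure X => ∫ x, f x ∂(m : Measure X) := by
  have h : ∀ m : FiniteMeasure X, ∫ x, f x ∂(m : Measure X) =
      (∫⁻ x, ENNReal.ofReal (f x) ∂(m : Measure X)).toReal -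
        (∫⁻ x, ENNReal.ofReal (-f x) ∂(m : Measure X)).toReal := fun m =>
    integral_eq_lintegral_pos_part_sub_lintegral_neg_part
      (Integrable.of_bound hf.aestronglyMeasurable C (ae_of_all _ hC))
  simp only [h]
  exact ((Measure.measurable_lintegral hf.ennreal_ofReal).comp measurable_subtype_coe).ennreal_toReal.sub
    ((Measure.measurable_lintegral hf.neg.ennreal_ofReal).comp measurable_subtype_coe).ennreal_toReal

end FiniteMeasure

/-! ### Lipschitz constants, joint measurability and integration for scaling laws. -/

section Measurability

variable {N : ℕ} {X : Type*}

theorem ScalingLaw.measurable_weight [PseudoEMetricSpace X] [MeasurableSpace X] (i : Fin N) :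
    Measurable fun s : ScalingLaw N X => s.weight i :=
  Measurable.of_comap_le <| le_sup_of_le_left <|
    le_iSup (fun i : Fin N => MeasurableSpace.comap (fun s : ScalingLaw N X => s.weight i) _) i

theorem ScalingLaw.measurable_map_apply [PseudoEMetricSpace X] [MeasurableSpace X] (i : Fin N)
    (x : X) : Measurable fun s : ScalingLaw N X => s.map i x :=
  Measurable.of_comap_le <| le_sup_of_le_right <| le_iSup₂_of_le i x le_rfl

theorem ScalingLaw.continuous_map [PseudoEMetricSpace X] (s : ScalingLaw N X) (i : Fin N) :
    Continuous (s.map i) :=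
  (s.lipschitz i).choose_spec.continuous

theorem ScalingLaw.toMeasure_combine [PseudoEMetricSpace X] [MeasurableSpace X]
    (s : ScalingLaw N X) (m : Fin N → FiniteMeasure X) :
    (s.combine m : Measure X) = ∑ i, s.weight i • (m i : Measure X).map (s.map i) := by
  simp [ScalingLaw.combine, FiniteMeasure.toMeasure_sum, FiniteMeasure.toMeasure_smul]

variable [MetricSpace X]

theorem ScalingLaw.lipConst_ne_top (s : ScalingLaw N X) (i : Fin N) : lipConst (s.map i) ≠ ∞ := by
  obtain ⟨K, hK⟩ := s.lipschitz i
  exact ne_top_of_le_ne_top ENNReal.coe_ne_top (iInf₂_le K hK)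

theorem edist_le_lipConst_mul (f : X → X) (x y : X) :
    edist (f x) (f y) ≤ lipConst f * edist x y := by
  rcases eq_or_ne (edist x y) 0 with h | h
  · rw [edist_eq_zero] at h
    simp [h]
  rw [← ENNReal.div_le_iff_le_mul (Or.inl h) (Or.inl (edist_ne_top x y))]
  refine le_iInf₂ fun K hK => ?_
  rw [ENNReal.div_le_iff_le_mul (Or.inl h) (Or.inl (edist_ne_top x y))]
  exact hK x y

theorem lipConst_le_coe_iff {f : X → X} {K : ℝ≥0} :
    lipConst f ≤ K ↔ LipschitzWith K f := by
  refine ⟨fun h x y => (edist_le_lipConst_mul f x y).trans (by gcongr), fun h => iInf₂_le K h⟩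

/-- Reduces the Lipschitz condition to countably many evaluations, the only data that the σ-algebra
on scaling laws controls directly. -/
theorem lipschitzWith_iff_dense {f : X → X} (hf : Continuous f) {D : Set X} (hD : Dense D)
    {K : ℝ≥0} : LipschitzWith K f ↔ ∀ x ∈ D, ∀ y ∈ D, edist (f x) (f y) ≤ K * edist x y := by
  refine ⟨fun h x _ y _ => h x y, fun h => ?_⟩
  rw [← lipschitzOnWith_univ, ← hD.closure_eq]
  refine LipschitzOnWith.closure hf.continuousOn ?_
  exact fun x hx y hy => h x hx y hy

/-- The contraction weight `p_i r_i ^ q` of the `i`-th branch. -/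
noncomputable def ScalingLaw.ratio (q : ℝ) (s : ScalingLaw N X) (i : Fin N) : ℝ≥0∞ :=
  s.weight i * lipConst (s.map i) ^ q

theorem ScalingLaw.ratio_ne_top {q : ℝ} (hq : 0 ≤ q) (s : ScalingLaw N X) (i : Fin N) :
    s.ratio q i ≠ ∞ :=
  ENNReal.mul_ne_top ENNReal.coe_ne_top (ENNReal.rpow_ne_top_of_nonneg hq (s.lipConst_ne_top i))

variable [SecondCountableTopology X] [MeasurableSpace X] [BorelSpace X]

theorem ScalingLaw.measurable_map (i : Fin N) :
    Measurable fun z : ScalingLaw N X × X => z.1.map i z.2 := by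
  have h := measurable_uncurry_of_continuous_of_measurable
    (u := fun (x : X) (s : ScalingLaw N X) => s.map i x)
    (fun s => s.continuous_map i) (fun x => ScalingLaw.measurable_map_apply i x)
  exact h.comp measurable_swap

theorem ScalingLaw.measurable_lipConst (i : Fin N) :
    Measurable fun s : ScalingLaw N X => lipConst (s.map i) := by
  refine measurable_of_Iic fun K => ?_
  induction K with
  | top => simp
  | coe K =>
    obtain ⟨D, hDc, hD⟩ := TopologicalSpace.exists_countable_dense X
    have : (fun s : ScalingLaw N X => lipConst (s.map i)) ⁻¹' Set.Iic (K : ℝ≥0∞) =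
        ⋂ x ∈ D, ⋂ y ∈ D,
          {s : ScalingLaw N X | edist (s.map i x) (s.map i y) ≤ K * edist x y} := by
      ext s
      simp only [Set.mem_preimage, Set.mem_Iic, Set.mem_iInter, Set.mem_ofPred_eq]
      rw [lipConst_le_coe_iff, lipschitzWith_iff_dense (s.continuous_map i) hD]
    rw [this]
    refine MeasurableSet.biInter hDc fun x _ => MeasurableSet.biInter hDc fun y _ => ?_
    exact measurableSet_le ((ScalingLaw.measurable_map_apply i x).edist
      (ScalingLaw.measurable_map_apply i y)) measurable_const

theorem ScalingLaw.measurable_ratio (q : ℝ) (i : Fin N) :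
    Measurable fun s : ScalingLaw N X => s.ratio q i :=
  (ScalingLaw.measurable_weight i).coe_nnreal_ennreal.mul
    ((ScalingLaw.measurable_lipConst i).pow_const q)

theorem ScalingLaw.measurable_combine :
    Measurable fun z : ScalingLaw N X × (Fin N → FiniteMeasure X) => z.1.combine z.2 := by
  rw [measurable_finiteMeasure_iff]
  intro A hA
  simp only [ScalingLaw.toMeasure_combine, Measure.coe_finsetSum, Finset.sum_apply,
    Measure.smul_apply]
  refine Finset.measurable_sum _ fun i _ => ?_
  simp only [ENNReal.smul_def, smul_eq_mul]
  refine ((ScalingLaw.measurable_weight i).comp measurable_fst).coe_nnreal_ennreal.mul ?_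
  -- The `S_i m`-mass of `A` is the `δ_s ⊗ m`-mass of the fixed measurable set `{(s, x) | S_i x ∈
  -- A}`, so measurability follows from that of the product of finite measures.
  let δ : ScalingLaw N X → FiniteMeasure (ScalingLaw N X) := fun s =>
    ⟨Measure.dirac s, inferInstance⟩
  have hδ : Measurable δ := Measurable.subtype_mk Measure.measurable_dirac
  have hT : MeasurableSet ((fun z : ScalingLaw N X × X => z.1.map i z.2) ⁻¹' A) :=
    ScalingLaw.measurable_map i hA
  have key := (Measure.measurable_coe hT).comp (FiniteMeasure.measurable_fun_prod.comp
    ((hδ.comp measurable_fst).prodMk ((measurable_pi_apply i).comp measurable_snd) :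
      Measurable fun z : ScalingLaw N X × (Fin N → FiniteMeasure X) => (δ z.1, z.2 i)))
  convert key using 2 with z
  rw [Measure.map_apply (z.1.continuous_map i).measurable hA]
  change _ = ((Measure.dirac z.1).prod (z.2 i : Measure X)) _
  rw [Measure.dirac_prod, Measure.map_apply measurable_prodMk_left hT]
  rfl

omit [SecondCountableTopology X] in
theorem ScalingLaw.lintegral_combine (s : ScalingLaw N X) (m : Fin N → FiniteMeasure X)
    {f : X → ℝ≥0∞} (hf : Measurable f) :
    ∫⁻ x, f x ∂(s.combine m : Measure X) =
      ∑ i, s.weight i * ∫⁻ x, f (s.map i x) ∂(m i : Measure X) := by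
  rw [ScalingLaw.toMeasure_combine, lintegral_finsetSum_measure]
  refine Finset.sum_congr rfl fun i _ => ?_
  rw [lintegral_smul_measure, lintegral_map hf (s.continuous_map i).measurable]
  rfl

omit [SecondCountableTopology X] in
theorem ScalingLaw.integral_combine (s : ScalingLaw N X) (m : Fin N → FiniteMeasure X)
    {f : X → ℝ} (hf : Measurable f) {C : ℝ} (hC : ∀ x, |f x| ≤ C) :
    ∫ x, f x ∂(s.combine m : Measure X) =
      ∑ i, (s.weight i : ℝ) * ∫ x, f (s.map i x) ∂(m i : Measure X) := by
  rw [ScalingLaw.toMeasure_combine, integral_finsetSum_measure]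
  · refine Finset.sum_congr rfl fun i _ => ?_
    rw [integral_smul_nnreal_measure, integral_map (s.continuous_map i).aemeasurable
      hf.aestronglyMeasurable]
    rfl
  · exact fun i _ => Integrable.of_bound hf.aestronglyMeasurable C (ae_of_all _ hC)

omit [SecondCountableTopology X] in
theorem ScalingLaw.mass_combine (s : ScalingLaw N X) (m : Fin N → FiniteMeasure X)
    (hs : ∑ i, s.weight i = 1) (hm : ∀ i, (m i).mass = 1) : (s.combine m).mass = 1 := by
  have h := s.lintegral_combine m (f := fun _ => 1) measurable_const
  simp only [lintegral_one, ← FiniteMeasure.ennreal_mass, hm, ENNReal.coe_one, mul_one] at h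
  rw [← ENNReal.ofNNReal_finsetSum, hs] at h
  exact_mod_cast h

end Measurability

/-! ### Independence of the root and the first-level subtrees. -/

section Tree

variable {N : ℕ} {X : Type*} [PseudoEMetricSpace X] [MeasurableSpace X]

/-- The root of a construction tree together with its first-level subtrees. -/
def rootSplit (ω : ConstructionTree N X) : ScalingLaw N X × (Fin N → ConstructionTree N X) :=
  (ω [], subtree ω)

theorem measurable_rootSplit : Measurable (rootSplit (N := N) (X := X)) := by
  unfold rootSplit subtree
  fun_prop

/-- The tree with given root and given first-level subtrees. -/
def graft (z : ScalingLaw N X × (Fin N → ConstructionTree N X)) : ConstructionTree N X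
  | [] => z.1
  | i :: σ => z.2 i σ

theorem measurable_graft : Measurable (graft (N := N) (X := X)) := by
  refine measurable_pi_lambda _ fun σ => ?_
  cases σ with
  | nil => exact measurable_fst
  | cons i σ =>
    exact (measurable_pi_apply σ).comp ((measurable_pi_apply i).comp measurable_snd)

/-- An infinite product measure is determined by finite cylinders; the preimage of a cylinder under
`graft` is again a box, and its factors regroup by the first letter of the word. -/
theorem map_graft (𝒮 : Measure (ScalingLaw N X)) [IsProbabilityMeasure 𝒮] :
    (𝒮.prod (Measure.pi fun _ : Fin N => treeMeasure 𝒮)).map graft = treeMeasure 𝒮 := by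
  classical
  refine Measure.eq_infinitePi _ fun s t ht => ?_
  -- Padding by the whole space gives the root a factor whether or not it belongs to `s`; the added
  -- factors have measure one.
  let t' : List (Fin N) → Set (ScalingLaw N X) := fun σ => if σ ∈ s then t σ else Set.univ
  have ht' : ∀ σ, MeasurableSet (t' σ) := fun σ => by
    by_cases h : σ ∈ s <;> simp [t', h, ht]
  let u : Fin N → Finset (List (Fin N)) := fun i => s.preimage (List.cons i) (by simp)
  have hset : graft ⁻¹' (Set.pi s t) =
      t' [] ×ˢ Set.univ.pi fun i => Set.pi (u i) fun σ => t' (i :: σ) := by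
    ext z
    simp only [Set.mem_preimage, Set.mem_pi, Set.mem_prod, Set.mem_univ, true_implies, t', u,
      Finset.mem_coe, Finset.mem_preimage]
    constructor
    · intro h
      refine ⟨?_, fun i σ hσ => ?_⟩
      · split_ifs with h0
        · exact h _ h0
        · trivial
      · rw [if_pos hσ]; exact h _ hσ
    · rintro ⟨h0, h1⟩ σ hσ
      cases σ with
      | nil => rw [if_pos hσ] at h0; exact h0
      | cons i σ => have := h1 i σ hσ; rw [if_pos hσ] at this; exact this
  rw [Measure.map_apply measurable_graft
    (MeasurableSet.pi s.countable_toSet fun σ _ => ht σ), hset, Measure.prod_prod, Measure.pi_pi]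
  simp only [treeMeasure]
  simp_rw [Measure.infinitePi_pi (μ := fun _ : List (Fin N) => 𝒮) (fun σ _ => ht' _)]
  have h1 : ∀ σ, σ ∉ s → 𝒮 (t' σ) = 1 := fun σ hσ => by simp [t', hσ]
  have h2 : ∀ σ ∈ s, 𝒮 (t' σ) = 𝒮 (t σ) := fun σ hσ => by simp [t', hσ]
  rw [← Finset.prod_congr rfl h2, Finset.prod_sigma']
  have h3 : ∏ x ∈ Finset.univ.sigma u, 𝒮 (t' (x.1 :: x.2)) =
      ∏ σ ∈ s.erase [], 𝒮 (t' σ) := by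
    refine Finset.prod_bij (fun x _ => x.1 :: x.2) ?_ ?_ ?_ ?_
    · intro x hx
      simp only [Finset.mem_sigma, Finset.mem_univ, true_and, u, Finset.mem_preimage] at hx
      simp [hx]
    · rintro ⟨i, σ⟩ _ ⟨j, τ⟩ _ h
      simp only [List.cons.injEq] at h
      obtain ⟨rfl, rfl⟩ := h
      rfl
    · intro σ hσ
      cases σ with
      | nil => simp at hσ
      | cons i σ =>
        refine ⟨⟨i, σ⟩, ?_, rfl⟩
        simpa [u] using hσ
    · intros; rfl
  rw [h3]
  by_cases h0 : [] ∈ s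
  · rw [Finset.mul_prod_erase s (fun σ => 𝒮 (t' σ)) h0]
  · rw [h1 _ h0, one_mul, Finset.erase_eq_of_notMem h0]

theorem map_rootSplit (𝒮 : Measure (ScalingLaw N X)) [IsProbabilityMeasure 𝒮] :
    (treeMeasure 𝒮).map rootSplit = 𝒮.prod (Measure.pi fun _ : Fin N => treeMeasure 𝒮) := by
  conv_lhs => rw [← map_graft 𝒮]
  rw [Measure.map_map measurable_rootSplit measurable_graft]
  exact Measure.map_id

theorem measurePreserving_root (𝒮 : Measure (ScalingLaw N X)) [IsProbabilityMeasure 𝒮] :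
    MeasurePreserving (fun ω : ConstructionTree N X => ω []) (treeMeasure 𝒮) 𝒮 :=
  measurePreserving_eval_infinitePi _ _

theorem measurePreserving_rootSplit_apply (𝒮 : Measure (ScalingLaw N X)) [IsProbabilityMeasure 𝒮]
    (i : Fin N) : MeasurePreserving (fun ω : ConstructionTree N X => (ω [], subtree ω i))
      (treeMeasure 𝒮) (𝒮.prod (treeMeasure 𝒮)) := by
  have h1 : MeasurePreserving rootSplit (treeMeasure 𝒮)
    (𝒮.prod (Measure.pi fun _ : Fin N => treeMeasure 𝒮)) := ⟨measurable_rootSplit, map_rootSplit 𝒮⟩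
  exact ((MeasurePreserving.id 𝒮).prod
    (measurePreserving_eval (fun _ : Fin N => treeMeasure 𝒮) i)).comp h1

theorem measurePreserving_subtree (𝒮 : Measure (ScalingLaw N X)) [IsProbabilityMeasure 𝒮]
    (i : Fin N) : MeasurePreserving (fun ω : ConstructionTree N X => subtree ω i)
      (treeMeasure 𝒮) (treeMeasure 𝒮) :=
  measurePreserving_snd.comp (measurePreserving_rootSplit_apply 𝒮 i)

theorem ae_forall_subtree {𝒮 : Measure (ScalingLaw N X)} [IsProbabilityMeasure 𝒮]
    {p : ConstructionTree N X → Prop} (h : ∀ᵐ ω ∂treeMeasure 𝒮, p ω) :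
    ∀ᵐ ω ∂treeMeasure 𝒮, ∀ i, p (subtree ω i) :=
  ae_all_iff.2 fun i => (measurePreserving_subtree 𝒮 i).quasiMeasurePreserving.ae h

end Tree

/-! ### The scaling operator on random measures over trees. -/

section TreeApply

variable {N : ℕ} {X : Type*} [MetricSpace X] [SecondCountableTopology X] [MeasurableSpace X]
  [BorelSpace X]

theorem measurable_treeApply {μ : ConstructionTree N X → FiniteMeasure X} (hμ : Measurable μ) :
    Measurable (treeApply μ) := by
  have h : Measurable fun ω : ConstructionTree N X => (ω [], fun i => μ (subtree ω i)) := by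
    refine (measurable_pi_apply _).prodMk (measurable_pi_lambda _ fun i => hμ.comp ?_)
    exact (measurable_pi_apply i).comp (measurable_snd.comp measurable_rootSplit)
  exact ScalingLaw.measurable_combine.comp h

theorem measurable_iterate_treeApply {μ : ConstructionTree N X → FiniteMeasure X}
    (hμ : Measurable μ) (n : ℕ) : Measurable (treeApply^[n] μ) := by
  induction n with
  | zero => exact hμ
  | succ n ih => rw [Function.iterate_succ_apply']; exact measurable_treeApply ih

/-- Links the pathwise operator with the operator on distributions: the values of `μ` at the
subtrees are independent copies, independent of the root. -/
theorem map_treeApply (𝒮 : Measure (ScalingLaw N X)) [IsProbabilityMeasure 𝒮]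
    {μ : ConstructionTree N X → FiniteMeasure X} (hμ : Measurable μ) :
    (treeMeasure 𝒮).map (treeApply μ) = distApply 𝒮 ((treeMeasure 𝒮).map μ) := by
  have hP : IsProbabilityMeasure ((treeMeasure 𝒮).map μ) :=
    Measure.isProbabilityMeasure_map hμ.aemeasurable
  have h1 : (𝒮.prod (Measure.pi fun _ : Fin N => treeMeasure 𝒮)).map
      (Prod.map id fun z i => μ (z i)) =
        𝒮.prod (Measure.pi fun _ : Fin N => (treeMeasure 𝒮).map μ) := by
    rw [← Measure.map_prod_map _ _ measurable_id (by fun_prop), Measure.map_id,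
      ← Measure.pi_map_pi fun _ => hμ.aemeasurable]
  rw [distApply, ← h1, ← map_rootSplit, Measure.map_map, Measure.map_map]
  · rfl
  · exact ScalingLaw.measurable_combine.comp (by fun_prop)
  · exact measurable_rootSplit
  · exact ScalingLaw.measurable_combine
  · fun_prop

theorem ae_mass_treeApply {𝒮 : Measure (ScalingLaw N X)} [IsProbabilityMeasure 𝒮]
    (hsum : ∀ᵐ s ∂𝒮, ∑ i, s.weight i = 1) {μ : ConstructionTree N X → FiniteMeasure X}
    (hμ : ∀ᵐ ω ∂treeMeasure 𝒮, (μ ω).mass = 1) :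
    ∀ᵐ ω ∂treeMeasure 𝒮, (treeApply μ ω).mass = 1 := by
  filter_upwards [(measurePreserving_root 𝒮).quasiMeasurePreserving.ae hsum,
    ae_forall_subtree hμ] with ω h1 h2
  exact ScalingLaw.mass_combine _ _ h1 h2

theorem ae_mass_iterate_treeApply {𝒮 : Measure (ScalingLaw N X)} [IsProbabilityMeasure 𝒮]
    (hsum : ∀ᵐ s ∂𝒮, ∑ i, s.weight i = 1) {μ : ConstructionTree N X → FiniteMeasure X}
    (hμ : ∀ᵐ ω ∂treeMeasure 𝒮, (μ ω).mass = 1) (n : ℕ) :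
    ∀ᵐ ω ∂treeMeasure 𝒮, (treeApply^[n] μ ω).mass = 1 := by
  induction n with
  | zero => exact hμ
  | succ n ih => rw [Function.iterate_succ_apply']; exact ae_mass_treeApply hsum ih

end TreeApply

/-! ### Couplings and their gluing along a sequence. -/

open Filter Topology ProbabilityTheory

/-- `π` is a coupling of `μ` and `ν`: its marginals are `μ` and `ν`. -/
def IsCoupling {X : Type*} [MeasurableSpace X] (π : Measure (X × X)) (μ ν : Measure X) : Prop :=
  π.map Prod.fst = μ ∧ π.map Prod.snd = ν

section Coupling

variable {X : Type*} [MeasurableSpace X] {π : Measure (X × X)} {μ ν : Measure X}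

theorem IsCoupling.isProbabilityMeasure [IsProbabilityMeasure μ] (h : IsCoupling π μ ν) :
    IsProbabilityMeasure π := by
  have h1 : IsProbabilityMeasure (π.map Prod.fst) := by rw [h.1]; infer_instance
  exact Measure.isProbabilityMeasure_of_map Prod.fst

theorem isCoupling_prod (μ ν : Measure X) [IsProbabilityMeasure μ] [IsProbabilityMeasure ν] :
    IsCoupling (μ.prod ν) μ ν := by
  constructor
  · rw [Measure.map_fst_prod]; simp
  · rw [Measure.map_snd_prod]; simp

theorem IsCoupling.lintegral_fst (h : IsCoupling π μ ν) {f : X → ℝ≥0∞} (hf : Measurable f) :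
    ∫⁻ z, f z.1 ∂π = ∫⁻ x, f x ∂μ := by
  rw [← h.1, lintegral_map hf measurable_fst]

theorem IsCoupling.lintegral_snd (h : IsCoupling π μ ν) {f : X → ℝ≥0∞} (hf : Measurable f) :
    ∫⁻ z, f z.2 ∂π = ∫⁻ x, f x ∂ν := by
  rw [← h.2, lintegral_map hf measurable_snd]

/-- The Markov property used in the gluing: if the next step depends on the past only through `g`,
the joint law of `g` and the next step is computed from the law of `g` alone. -/
theorem map_compProd_comap {α β γ : Type*} [MeasurableSpace α] [MeasurableSpace β]
    [MeasurableSpace γ] (ρ : Measure α) [IsProbabilityMeasure ρ] (κ : Kernel β γ)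
    [IsMarkovKernel κ] {g : α → β} (hg : Measurable g) :
    (ρ ⊗ₘ κ.comap g hg).map (Prod.map g id) = ρ.map g ⊗ₘ κ := by
  have : IsProbabilityMeasure (ρ.map g) := Measure.isProbabilityMeasure_map hg.aemeasurable
  have hm : Measurable (Prod.map g id : α × γ → β × γ) := hg.prodMap measurable_id
  ext s hs
  rw [Measure.map_apply hm hs, Measure.compProd_apply (hm hs), Measure.compProd_apply hs,
    lintegral_map (Kernel.measurable_kernel_prodMk_left hs) hg]
  rfl

/-- Gluing of infinitely many couplings of consecutive measures. -/
theorem exists_chain [StandardBorelSpace X] [Nonempty X] {μ : ℕ → Measure X}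
    [∀ n, IsProbabilityMeasure (μ n)] {π : ℕ → Measure (X × X)}
    (hπ : ∀ n, IsCoupling (π n) (μ n) (μ (n + 1))) :
    ∃ Q : Measure (ℕ → X), IsProbabilityMeasure Q ∧
      ∀ n, Q.map (fun x => (x n, x (n + 1))) = π n := by
  have hp : ∀ n, IsProbabilityMeasure (π n) := fun n => (hπ n).isProbabilityMeasure
  -- The chain is Markov: given the past, the next point is drawn from the disintegration of `π n`
  -- over the current point only. The Ionescu-Tulcea construction supplies the law `Q` of the
  -- trajectory.
  let κ : (n : ℕ) → Kernel (Π _ : Finset.Iic n, X) X := fun n =>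
    (π n).condKernel.comap (fun x => x ⟨n, by simp⟩) (measurable_pi_apply _)
  have hκ : ∀ n, IsMarkovKernel (κ n) := fun n => by dsimp only [κ]; infer_instance
  let Q : Measure (ℕ → X) := Kernel.trajMeasure (X := fun _ => X) (μ 0) κ
  have hQ : IsProbabilityMeasure Q := by dsimp only [Q]; infer_instance
  -- The marginal at time `n` determines the pair law at times `n, n + 1`, whose second marginal is
  -- the law at time `n + 1`; this drives the induction for `hlaw`.
  have hstep : ∀ n, Q.map (fun x => x n) = μ n → Q.map (fun x => (x n, x (n + 1))) = π n := by
    intro n hn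
    have h1 := Kernel.map_frestrictLe_trajMeasure_compProd_eq_map_trajMeasure
      (X := fun _ => X) (μ₀ := μ 0) (κ := κ) (a := n)
    have hP : IsProbabilityMeasure (Q.map (Preorder.frestrictLe (π := fun _ => X) n)) :=
      Measure.isProbabilityMeasure_map (by fun_prop)
    have h2 := map_compProd_comap (Q.map (Preorder.frestrictLe (π := fun _ => X) n))
      (π n).condKernel (g := fun x => x ⟨n, by simp⟩) (measurable_pi_apply _)
    change _ ⊗ₘ κ n = _ at h1
    change (_ ⊗ₘ κ n).map _ = _ at h2
    rw [h1, Measure.map_map (by fun_prop) (by fun_prop), Measure.map_map (by fun_prop) (by fun_prop)]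
      at h2
    have h3 : (Q.map ((fun x : Π _ : Finset.Iic n, X => x ⟨n, by simp⟩) ∘
        (Preorder.frestrictLe (π := fun _ => X) n))) = (π n).fst := by
      rw [Measure.fst, (hπ n).1, ← hn]; rfl
    rw [h3, Measure.disintegrate] at h2
    exact h2
  have hlaw : ∀ n, Q.map (fun x => x n) = μ n := by
    intro n
    induction n with
    | zero =>
      have h1 : Q.map (Preorder.frestrictLe (π := fun _ => X) 0) =
          (μ 0).map (MeasurableEquiv.piUnique (fun _ : Finset.Iic 0 => X)).symm := by
        dsimp only [Q]
        rw [Kernel.trajMeasure, Measure.map_comp _ _ (by fun_prop), Kernel.traj_map_frestrictLe,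
          Kernel.partialTraj_self, Measure.id_comp]
      have h2 : (fun x : ℕ → X => x 0) = (MeasurableEquiv.piUnique (fun _ : Finset.Iic 0 => X)) ∘
          (Preorder.frestrictLe (π := fun _ => X) 0) := by
        ext x; rfl
      rw [h2, ← Measure.map_map (by fun_prop) (by fun_prop), h1, Measure.map_map (by fun_prop) (by fun_prop)]
      exact Measure.map_id
    | succ n ih =>
      have h := hstep n ih
      rw [← (hπ n).2, ← h, Measure.map_map (by fun_prop) (by fun_prop)]
      rfl
  exact ⟨Q, hQ, fun n => hstep n (hlaw n)⟩

end Coupling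

/-! ### Triangle inequality, completeness and contraction for the minimal metric. -/

section MinimalMetric

variable {X : Type*} [MetricSpace X] [MeasurableSpace X] {q : ℝ}

theorem minimalMetric_eq_iInf (hq : 0 < q) (hq1 : q ≤ 1) (μ ν : FiniteMeasure X) :
    minimalMetric q μ ν = ⨅ (π : Measure (X × X)) (_ : IsCoupling π (μ : Measure X) ν),
      ∫⁻ z, edist z.1 z.2 ^ q ∂π := by
  have h : min (1 / q) 1 = 1 := min_eq_right (by rw [le_div_iff₀ hq]; linarith)
  simp only [minimalMetric, h, ENNReal.rpow_one]
  rfl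

theorem minimalMetric_le_lintegral (hq : 0 < q) (hq1 : q ≤ 1) {μ ν : FiniteMeasure X}
    {π : Measure (X × X)} (h : IsCoupling π (μ : Measure X) ν) :
    minimalMetric q μ ν ≤ ∫⁻ z, edist z.1 z.2 ^ q ∂π := by
  rw [minimalMetric_eq_iInf hq hq1]
  exact iInf₂_le π h

theorem exists_coupling_lt (hq : 0 < q) (hq1 : q ≤ 1) {μ ν : FiniteMeasure X} {c : ℝ≥0∞}
    (h : minimalMetric q μ ν < c) :
    ∃ π : Measure (X × X), IsCoupling π (μ : Measure X) ν ∧ ∫⁻ z, edist z.1 z.2 ^ q ∂π < c := by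
  rw [minimalMetric_eq_iInf hq hq1] at h
  simpa [iInf_lt_iff] using h

omit [MetricSpace X] in
theorem isProbabilityMeasure_of_mass {μ : FiniteMeasure X} (h : μ.mass = 1) :
    IsProbabilityMeasure (μ : Measure X) :=
  ⟨by rw [← FiniteMeasure.ennreal_mass, h]; rfl⟩

omit [MeasurableSpace X] in
theorem edist_rpow_triangle (hq : 0 < q) (hq1 : q ≤ 1) (x y z : X) :
    edist x z ^ q ≤ edist x y ^ q + edist y z ^ q :=
  (ENNReal.rpow_le_rpow (edist_triangle x y z) hq.le).trans
    (ENNReal.rpow_add_le_add_rpow _ _ hq.le hq1)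

variable [SecondCountableTopology X] [BorelSpace X]

theorem measurable_edist_rpow : Measurable fun z : X × X => edist z.1 z.2 ^ q :=
  measurable_edist.pow_const q

omit [MetricSpace X] [SecondCountableTopology X] [BorelSpace X] in
theorem nonempty_of_mass {μ : FiniteMeasure X} (h : μ.mass = 1) : Nonempty X := by
  by_contra hX
  rw [not_nonempty_iff] at hX
  have := isProbabilityMeasure_of_mass h
  have h1 : (μ : Measure X) Set.univ = 1 := measure_univ
  simp [Set.eq_empty_of_isEmpty] at h1

theorem minimalMetric_triangle [CompleteSpace X] (hq : 0 < q) (hq1 : q ≤ 1)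
    {μ ν ρ : FiniteMeasure X} (hμ : μ.mass = 1) (hν : ν.mass = 1) (hρ : ρ.mass = 1) :
    minimalMetric q μ ρ ≤ minimalMetric q μ ν + minimalMetric q ν ρ := by
  have := nonempty_of_mass hμ
  have := isProbabilityMeasure_of_mass hμ
  have := isProbabilityMeasure_of_mass hν
  have := isProbabilityMeasure_of_mass hρ
  refine ENNReal.le_of_forall_pos_le_add fun ε hε hlt => ?_
  have h12 := ENNReal.add_lt_top.1 hlt
  have hε2 : ((ε / 2 : ℝ≥0) : ℝ≥0∞) ≠ 0 := by
    simpa using hε.ne'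
  obtain ⟨π₁, hπ₁, hc₁⟩ := exists_coupling_lt hq hq1 (ENNReal.lt_add_right h12.1.ne hε2)
  obtain ⟨π₂, hπ₂, hc₂⟩ := exists_coupling_lt hq hq1 (ENNReal.lt_add_right h12.2.ne hε2)
  -- The gluing result takes infinite sequences, so the chain `μ, ν, ρ` is continued by constant
  -- steps, coupled along the diagonal.
  let m : ℕ → Measure X := fun n => match n with
    | 0 => μ
    | 1 => ν
    | _ => ρ
  let π : ℕ → Measure (X × X) := fun n => match n with
    | 0 => π₁
    | 1 => π₂
    | _ => (ρ : Measure X).map fun x => (x, x)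
  have hm : ∀ n, IsProbabilityMeasure (m n) := fun n => by
    rcases n with _ | _ | n
    · exact isProbabilityMeasure_of_mass hμ
    · exact isProbabilityMeasure_of_mass hν
    · exact isProbabilityMeasure_of_mass hρ
  have hd : IsCoupling ((ρ : Measure X).map fun x => (x, x)) ρ ρ := by
    constructor <;>
    · rw [Measure.map_map (by fun_prop) (by fun_prop)]
      exact Measure.map_id
  obtain ⟨Q, _, hQ⟩ := exists_chain (μ := m) (π := π) fun n => by
    rcases n with _ | _ | n
    exacts [hπ₁, hπ₂, hd]
  have e1 : Q.map (fun x => (x 0, x 1)) = π₁ := hQ 0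
  have e2 : Q.map (fun x => (x 1, x 2)) = π₂ := hQ 1
  have hc : IsCoupling (Q.map fun x => (x 0, x 2)) (μ : Measure X) ρ := by
    constructor
    · rw [← hπ₁.1, ← e1, Measure.map_map (by fun_prop) (by fun_prop),
        Measure.map_map (by fun_prop) (by fun_prop)]
      rfl
    · rw [← hπ₂.2, ← e2, Measure.map_map (by fun_prop) (by fun_prop),
        Measure.map_map (by fun_prop) (by fun_prop)]
      rfl
  rw [← e1, lintegral_map measurable_edist_rpow (by fun_prop)] at hc₁
  rw [← e2, lintegral_map measurable_edist_rpow (by fun_prop)] at hc₂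
  calc minimalMetric q μ ρ ≤ ∫⁻ x : ℕ → X, edist (x 0) (x 2) ^ q ∂Q := by
        refine (minimalMetric_le_lintegral hq hq1 hc).trans_eq ?_
        rw [lintegral_map measurable_edist_rpow (by fun_prop)]
    _ ≤ ∫⁻ x : ℕ → X, (edist (x 0) (x 1) ^ q + edist (x 1) (x 2) ^ q) ∂Q :=
        lintegral_mono fun x => edist_rpow_triangle hq hq1 _ _ _
    _ = (∫⁻ x : ℕ → X, edist (x 0) (x 1) ^ q ∂Q) + ∫⁻ x : ℕ → X, edist (x 1) (x 2) ^ q ∂Q :=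
        lintegral_add_left (by fun_prop) _
    _ ≤ (minimalMetric q μ ν + (ε / 2 : ℝ≥0)) + (minimalMetric q ν ρ + (ε / 2 : ℝ≥0)) :=
        add_le_add hc₁.le hc₂.le
    _ = minimalMetric q μ ν + minimalMetric q ν ρ + ε := by
        rw [add_add_add_comm, ← ENNReal.coe_add, add_halves]

/-- Every `a n ^ q` is at most the sum `S`, hence `a n ≤ S ^ (1/q - 1) * a n ^ q`. It turns summable
`d ^ q` increments into summable `d` increments, so that the glued sequence is Cauchy. -/
theorem tsum_ne_top_of_tsum_rpow (hq : 0 < q) (hq1 : q ≤ 1) {a : ℕ → ℝ≥0∞}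
    (h : ∑' n, a n ^ q ≠ ∞) : ∑' n, a n ≠ ∞ := by
  set S := ∑' n, a n ^ q with hS
  have h1 : 0 ≤ 1 / q - 1 := by
    rw [sub_nonneg, le_div_iff₀ hq]; linarith
  have hle : ∀ n, a n ≤ S ^ (1 / q - 1) * a n ^ q := fun n => by
    calc a n = (a n ^ q) ^ ((1 / q - 1) + 1) := by
          rw [← ENNReal.rpow_mul]; field_simp; simp
      _ = (a n ^ q) ^ (1 / q - 1) * a n ^ q := by
          rw [ENNReal.rpow_add_of_nonneg _ _ h1 zero_le_one, ENNReal.rpow_one]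
      _ ≤ S ^ (1 / q - 1) * a n ^ q := by
          gcongr
          exact ENNReal.le_tsum n
  refine ne_top_of_le_ne_top ?_ (ENNReal.tsum_le_tsum hle)
  rw [ENNReal.tsum_mul_left]
  exact ENNReal.mul_ne_top (ENNReal.rpow_ne_top_of_nonneg h1 h) h

omit [SecondCountableTopology X] [MeasurableSpace X] [BorelSpace X] in
theorem edist_rpow_le_tsum (hq : 0 < q) (hq1 : q ≤ 1) {x : ℕ → X} {y : X}
    (hx : Tendsto x atTop (𝓝 y)) (n : ℕ) :
    edist (x n) y ^ q ≤ ∑' k, edist (x (n + k)) (x (n + k + 1)) ^ q := by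
  have h1 : ∀ m, edist (x n) (x (n + m)) ^ q ≤
      ∑ k ∈ Finset.range m, edist (x (n + k)) (x (n + k + 1)) ^ q := by
    intro m
    induction m with
    | zero => simp [hq]
    | succ m ih =>
      rw [Finset.sum_range_succ]
      exact (edist_rpow_triangle hq hq1 _ (x (n + m)) _).trans (add_le_add_left ih _)
  have h2 : Tendsto (fun m => edist (x n) (x (n + m)) ^ q) atTop (𝓝 (edist (x n) y ^ q)) := by
    refine (ENNReal.continuous_rpow_const.tendsto _).comp ?_
    refine Tendsto.edist tendsto_const_nhds (hx.comp ?_)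
    exact tendsto_atTop_mono (fun m => Nat.le_add_left m n) tendsto_id
  exact le_of_tendsto h2 (Eventually.of_forall fun m => (h1 m).trans (ENNReal.sum_le_tsum _))

/-- All measures are realised as the coordinates of one random sequence. Its expected `d ^ q`
increments are summable, so it converges almost surely; the limit measure is the law of the limit
point, and the joint law of the `n`-th point and the limit is a coupling with the stated cost. -/
theorem exists_limit_of_lt [CompleteSpace X] (hq : 0 < q) (hq1 : q ≤ 1) {μ : ℕ → FiniteMeasure X}
    (hμ : ∀ n, (μ n).mass = 1) {b : ℕ → ℝ≥0∞}
    (hb : ∀ n, minimalMetric q (μ n) (μ (n + 1)) < b n) (hsum : ∑' n, b n ≠ ∞) :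
    ∃ ν : FiniteMeasure X, ν.mass = 1 ∧ ∀ n, minimalMetric q (μ n) ν ≤ ∑' k, b (n + k) := by
  have := nonempty_of_mass (hμ 0)
  have hP := fun n => isProbabilityMeasure_of_mass (hμ n)
  choose π hπ hc using fun n => exists_coupling_lt hq hq1 (hb n)
  obtain ⟨Q, _, hQ⟩ := exists_chain hπ
  have hcost : ∀ n, ∫⁻ x : ℕ → X, edist (x n) (x (n + 1)) ^ q ∂Q < b n := fun n => by
    have := hc n
    rwa [← hQ n, lintegral_map measurable_edist_rpow (by fun_prop)] at this
  have hfin : ∀ᵐ x : ℕ → X ∂Q, ∑' n, edist (x n) (x (n + 1)) ^ q < ∞ := by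
    refine ae_lt_top (Measurable.tsum fun n => by fun_prop) ?_
    rw [lintegral_tsum fun n => by fun_prop]
    exact ne_top_of_le_ne_top hsum (ENNReal.tsum_le_tsum fun n => (hcost n).le)
  have hlim : ∀ᵐ x : ℕ → X ∂Q, ∃ y, Tendsto (fun n => x n) atTop (𝓝 y) := by
    filter_upwards [hfin] with x hx
    exact cauchySeq_tendsto_of_complete (cauchySeq_of_edist_le_of_tsum_ne_top _ (fun n => le_rfl)
      (tsum_ne_top_of_tsum_rpow hq hq1 hx.ne))
  obtain ⟨y, hy, hlim'⟩ := measurable_limit_of_tendsto_metrizable_ae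
    (fun n => (measurable_pi_apply n).aemeasurable) hlim
  have hν : IsProbabilityMeasure (Q.map y) := Measure.isProbabilityMeasure_map hy.aemeasurable
  let ν : FiniteMeasure X := ⟨Q.map y, inferInstance⟩
  refine ⟨ν, ?_, fun n => ?_⟩
  · rw [← ENNReal.coe_inj, FiniteMeasure.ennreal_mass]
    exact hν.measure_univ
  have hcp : IsCoupling (Q.map fun x => (x n, y x)) (μ n : Measure X) (Q.map y) := by
    constructor
    · rw [← (hπ n).1, ← hQ n, Measure.map_map (by fun_prop) (by fun_prop),
        Measure.map_map (by fun_prop) (by fun_prop)]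
      rfl
    · rw [Measure.map_map (by fun_prop) (by fun_prop)]
      rfl
  refine (minimalMetric_le_lintegral hq hq1 (ν := ν) hcp).trans ?_
  rw [lintegral_map measurable_edist_rpow (by fun_prop)]
  calc ∫⁻ x : ℕ → X, edist (x n) (y x) ^ q ∂Q
      ≤ ∫⁻ x : ℕ → X, ∑' k, edist (x (n + k)) (x (n + k + 1)) ^ q ∂Q := by
        refine lintegral_mono_ae ?_
        filter_upwards [hlim'] with x hx
        exact edist_rpow_le_tsum hq hq1 hx n
    _ = ∑' k, ∫⁻ x : ℕ → X, edist (x (n + k)) (x (n + k + 1)) ^ q ∂Q :=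
        lintegral_tsum fun k => by fun_prop
    _ ≤ ∑' k, b (n + k) := ENNReal.tsum_le_tsum fun k => (hcost _).le

/-- Completeness of the minimal metric on unit mass measures, with a rate. -/
theorem exists_limit_minimalMetric [CompleteSpace X] (hq : 0 < q) (hq1 : q ≤ 1)
    {μ : ℕ → FiniteMeasure X} (hμ : ∀ n, (μ n).mass = 1)
    (hsum : ∑' n, minimalMetric q (μ n) (μ (n + 1)) ≠ ∞) :
    ∃ ν : FiniteMeasure X, ν.mass = 1 ∧
      ∀ n, minimalMetric q (μ n) ν ≤ ∑' k, minimalMetric q (μ (n + k)) (μ (n + k + 1)) := by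
  let L : ℕ → ℝ≥0∞ := fun n => minimalMetric q (μ n) (μ (n + 1))
  have hL : ∀ n, L n ≠ ∞ := ENNReal.ne_top_of_tsum_ne_top hsum
  -- Optimal couplings are not assumed to exist; a summable slack leaves room for strictly cheaper
  -- ones.
  have hb : ∑' n, (L n + 2⁻¹ ^ n) ≠ ∞ := by
    rw [ENNReal.tsum_add]
    refine ENNReal.add_ne_top.2 ⟨hsum, ?_⟩
    rw [ENNReal.tsum_geometric, ENNReal.one_sub_inv_two, inv_inv]
    exact ENNReal.ofNat_ne_top
  obtain ⟨ν, hν, hle⟩ := exists_limit_of_lt hq hq1 hμ (b := fun n => L n + 2⁻¹ ^ n)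
    (fun n => ENNReal.lt_add_right (hL n) (by simp)) hb
  refine ⟨ν, hν, fun n => ?_⟩
  -- The slack disappears from the final rate: the triangle inequality up to time `n + m` uses exact
  -- distances, and the remaining distance tends to zero as `m` grows.
  have h1 : ∀ m, minimalMetric q (μ n) ν ≤
      ∑ k ∈ Finset.range m, L (n + k) + minimalMetric q (μ (n + m)) ν := by
    intro m
    induction m with
    | zero => simp
    | succ m ih =>
      rw [Finset.sum_range_succ, add_assoc]
      refine ih.trans (add_le_add_right ?_ _)
      exact minimalMetric_triangle hq hq1 (hμ _) (hμ _) hν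
  have h2 : Tendsto (fun m => minimalMetric q (μ (n + m)) ν) atTop (𝓝 0) := by
    refine tendsto_of_tendsto_of_tendsto_of_le_of_le tendsto_const_nhds ?_ (fun _ => zero_le)
      (fun m => hle (n + m))
    have := ENNReal.tendsto_sum_nat_add _ hb
    refine (this.comp (tendsto_add_atTop_nat n)).congr fun m => ?_
    refine tsum_congr fun k => ?_
    rw [show k + (m + n) = n + m + k by ring]
  refine ge_of_tendsto' (x := atTop) (f := fun m => ∑' k, L (n + k) +
    minimalMetric q (μ (n + m)) ν) ?_ (fun m => (h1 m).trans ?_)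
  · simpa using h2.const_add (∑' k, L (n + k))
  · gcongr
    exact ENNReal.sum_le_tsum _

-- The weight is kept inside to cover infinite distances: for `w = 0` any coupling costs `0 * ∞ =
-- 0`, and for `w ≠ 0` with infinite distance the right-hand side is infinite.
omit [SecondCountableTopology X] [BorelSpace X] in
theorem exists_coupling_mul_le (hq : 0 < q) (hq1 : q ≤ 1) {μ ν : FiniteMeasure X}
    (hμ : μ.mass = 1) (hν : ν.mass = 1) {w : ℝ≥0∞} (hw : w ≠ ∞) {ε : ℝ≥0∞} (hε : ε ≠ 0) :
    ∃ π : Measure (X × X), IsCoupling π (μ : Measure X) ν ∧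
      w * ∫⁻ z, edist z.1 z.2 ^ q ∂π ≤ w * minimalMetric q μ ν + ε := by
  have := isProbabilityMeasure_of_mass hμ
  have := isProbabilityMeasure_of_mass hν
  rcases eq_or_ne w 0 with rfl | hw0
  · exact ⟨_, isCoupling_prod _ _, by simp⟩
  rcases eq_or_ne (minimalMetric q μ ν) ∞ with h | h
  · exact ⟨_, isCoupling_prod _ _, by simp [h, hw0]⟩
  obtain ⟨π, hπ, hc⟩ := exists_coupling_lt hq hq1
    (ENNReal.lt_add_right h (ENNReal.div_ne_zero.2 ⟨hε, hw⟩))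
  refine ⟨π, hπ, (mul_le_mul_right hc.le w).trans ?_⟩
  rw [mul_add, ENNReal.mul_div_cancel hw0 hw]

/-- Near-optimal couplings of `m i` and `m' i`, pushed forward by `S_i × S_i` and summed with
weights `p_i`, couple the combined measures; each map stretches `d ^ q` by at most `r_i ^ q`. The
error is shared equally among the `N` branches. -/
theorem minimalMetric_combine_le {N : ℕ} (hq : 0 < q) (hq1 : q ≤ 1) (s : ScalingLaw N X)
    {m m' : Fin N → FiniteMeasure X} (hm : ∀ i, (m i).mass = 1) (hm' : ∀ i, (m' i).mass = 1) :
    minimalMetric q (s.combine m) (s.combine m') ≤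
      ∑ i, s.ratio q i * minimalMetric q (m i) (m' i) := by
  refine ENNReal.le_of_forall_pos_le_add fun ε hε _ => ?_
  have hε' : (ε : ℝ≥0∞) / N ≠ 0 :=
    ENNReal.div_ne_zero.2 ⟨by simpa using hε.ne', ENNReal.natCast_ne_top N⟩
  choose π hπ hc using fun i => exists_coupling_mul_le hq hq1 (hm i) (hm' i)
    (s.ratio_ne_top hq.le i) hε'
  have hS : ∀ i, Measurable (Prod.map (s.map i) (s.map i)) := fun i =>
    (s.continuous_map i).measurable.prodMap (s.continuous_map i).measurable
  have hcp : IsCoupling (∑ i, s.weight i • (π i).map (Prod.map (s.map i) (s.map i)))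
      (s.combine m : Measure X) (s.combine m') := by
    constructor
    · rw [ScalingLaw.toMeasure_combine, Measure.map_finset_sum measurable_fst.aemeasurable]
      refine Finset.sum_congr rfl fun i _ => ?_
      rw [Measure.map_smul, Measure.map_map measurable_fst (hS i), ← (hπ i).1,
        Measure.map_map (s.continuous_map i).measurable measurable_fst]
      rfl
    · rw [ScalingLaw.toMeasure_combine, Measure.map_finset_sum measurable_snd.aemeasurable]
      refine Finset.sum_congr rfl fun i _ => ?_
      rw [Measure.map_smul, Measure.map_map measurable_snd (hS i), ← (hπ i).2,
        Measure.map_map (s.continuous_map i).measurable measurable_snd]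
      rfl
  refine (minimalMetric_le_lintegral hq hq1 hcp).trans ?_
  rw [lintegral_finsetSum_measure]
  calc ∑ i, ∫⁻ z, edist z.1 z.2 ^ q ∂(s.weight i • (π i).map (Prod.map (s.map i) (s.map i)))
      ≤ ∑ i, s.ratio q i * ∫⁻ z, edist z.1 z.2 ^ q ∂(π i) := by
        refine Finset.sum_le_sum fun i _ => ?_
        rw [lintegral_smul_measure, lintegral_map measurable_edist_rpow (hS i), ScalingLaw.ratio,
          mul_assoc, ← lintegral_const_mul _ measurable_edist_rpow]
        refine mul_le_mul_right (lintegral_mono fun z => ?_) _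
        rw [← ENNReal.mul_rpow_of_nonneg _ _ hq.le]
        exact ENNReal.rpow_le_rpow (edist_le_lipConst_mul (s.map i) _ _) hq.le
    _ ≤ ∑ i, (s.ratio q i * minimalMetric q (m i) (m' i) + ε / N) :=
        Finset.sum_le_sum fun i _ => hc i
    _ ≤ ∑ i, s.ratio q i * minimalMetric q (m i) (m' i) + ε := by
        rw [Finset.sum_add_distrib]
        gcongr
        simp only [Finset.sum_const, Finset.card_univ, Fintype.card_fin, nsmul_eq_mul]
        exact ENNReal.mul_div_le

theorem mem_Mq_of_minimalMetric_ne_top (hq : 0 < q) (hq1 : q ≤ 1) {μ ν : FiniteMeasure X}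
    (hμ : μ ∈ Mq X q) (hν : ν.mass = 1) (h : minimalMetric q μ ν ≠ ∞) : ν ∈ Mq X q := by
  obtain ⟨-, a, ha⟩ := hμ
  obtain ⟨π, hπ, hc⟩ := exists_coupling_lt hq hq1 h.lt_top
  refine ⟨hν, a, ?_⟩
  have hm : Measurable fun x : X => edist x a ^ q := by fun_prop
  rw [← hπ.lintegral_snd hm]
  calc ∫⁻ z, edist z.2 a ^ q ∂π ≤ ∫⁻ z, (edist z.1 z.2 ^ q + edist z.1 a ^ q) ∂π :=
        lintegral_mono fun z => by
          simpa only [edist_comm z.2 z.1] using edist_rpow_triangle hq hq1 z.2 z.1 a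
    _ = (∫⁻ z, edist z.1 z.2 ^ q ∂π) + ∫⁻ x, edist x a ^ q ∂(μ : Measure X) := by
        rw [lintegral_add_left measurable_edist_rpow, hπ.lintegral_fst hm]
    _ < ∞ := ENNReal.add_lt_top.2 ⟨hc, ha⟩

theorem edist_integral_le_lintegral {Ω : Type*} [MeasurableSpace Ω] {μ : Measure Ω} {f g : Ω → ℝ}
    (hf : Integrable f μ) (hg : Integrable g μ) :
    edist (∫ x, f x ∂μ) (∫ x, g x ∂μ) ≤ ∫⁻ x, edist (f x) (g x) ∂μ := by
  simp only [edist_eq_enorm_sub]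
  rw [← integral_sub hf hg]
  exact enorm_integral_le_lintegral_enorm _

/-- The easy half of Kantorovich duality, checked against each coupling. The condition `u ≠ 0`
allows dividing by `u` before passing to the infimum. -/
theorem edist_integral_le_minimalMetric (hq : 0 < q) (hq1 : q ≤ 1) {μ ν : FiniteMeasure X}
    {f : X → ℝ} (hf : Measurable f) {C : ℝ} (hC : ∀ x, |f x| ≤ C) {u : ℝ≥0} (hu : u ≠ 0)
    (h : ∀ x y, edist (f x) (f y) ≤ u * edist x y ^ q) :
    edist (∫ x, f x ∂(μ : Measure X)) (∫ x, f x ∂(ν : Measure X)) ≤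
      u * minimalMetric q μ ν := by
  rw [mul_comm, ← ENNReal.div_le_iff_le_mul (Or.inl (by simpa)) (Or.inl ENNReal.coe_ne_top),
    minimalMetric_eq_iInf hq hq1]
  refine le_iInf₂ fun π hπ => ?_
  rw [ENNReal.div_le_iff_le_mul (Or.inl (by simpa)) (Or.inl ENNReal.coe_ne_top), mul_comm,
    ← lintegral_const_mul _ measurable_edist_rpow]
  have hfin : IsFiniteMeasure π := by
    refine ⟨?_⟩
    have : (μ : Measure X) Set.univ < ∞ := measure_lt_top _ _
    rwa [← hπ.1, Measure.map_apply measurable_fst MeasurableSet.univ] at this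
  have e1 : ∫ x, f x ∂(μ : Measure X) = ∫ z, f z.1 ∂π := by
    rw [← hπ.1, integral_map measurable_fst.aemeasurable hf.aestronglyMeasurable]
  have e2 : ∫ x, f x ∂(ν : Measure X) = ∫ z, f z.2 ∂π := by
    rw [← hπ.2, integral_map measurable_snd.aemeasurable hf.aestronglyMeasurable]
  rw [e1, e2]
  refine (edist_integral_le_lintegral ?_ ?_).trans (lintegral_mono fun z => h z.1 z.2)
  · exact Integrable.of_bound (hf.comp measurable_fst).aestronglyMeasurable C
      (ae_of_all _ fun z => hC z.1)
  · exact Integrable.of_bound (hf.comp measurable_snd).aestronglyMeasurable C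
      (ae_of_all _ fun z => hC z.2)

end MinimalMetric

/-! ### Calculus of weak `L¹` tails. -/

/-- `P(f ≥ t) ≤ c / t` for all `t`, with an explicit constant `c`. -/
def WeakTail {Ω : Type*} [MeasurableSpace Ω] (P : Measure Ω) (f : Ω → ℝ≥0∞) (c : ℝ≥0∞) : Prop :=
  ∀ t : ℝ≥0, t * P {ω | (t : ℝ≥0∞) ≤ f ω} ≤ c

section WeakTail

variable {Ω : Type*} [MeasurableSpace Ω] {P : Measure Ω} {f g : Ω → ℝ≥0∞} {c d : ℝ≥0∞}

theorem WeakTail.mono (h : WeakTail P g c) (hfg : ∀ᵐ ω ∂P, f ω ≤ g ω) (hcd : c ≤ d) :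
    WeakTail P f d := fun t => by
  refine le_trans ?_ ((h t).trans hcd)
  gcongr 1
  refine measure_mono_ae ?_
  filter_upwards [hfg] with ω hω ht
  exact le_trans ht hω

theorem HasWeakTail.exists_weakTail (h : HasWeakTail P f) : ∃ c : ℝ≥0, WeakTail P f c := by
  obtain ⟨γ, hγ, h⟩ := h
  refine ⟨γ.toNNReal, fun t => ?_⟩
  rcases eq_or_ne t 0 with rfl | ht
  · simp
  have ht' : 0 < (t : ℝ) := by positivity
  have h1 := h t ht'
  rw [ENNReal.ofReal_coe_nnreal] at h1
  calc (t : ℝ≥0∞) * P {ω | (t : ℝ≥0∞) ≤ f ω} ≤ t * ENNReal.ofReal (γ / t) := by gcongr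
    _ = ENNReal.ofReal (t * (γ / t)) := by
      rw [ENNReal.ofReal_mul ht'.le, ENNReal.ofReal_coe_nnreal]
    _ = γ.toNNReal := by
      rw [mul_div_cancel₀ _ ht'.ne']; rfl

theorem WeakTail.measure_le (h : WeakTail P f c) {C : ℝ} (hC : c ≤ ENNReal.ofReal C) {t : ℝ}
    (ht : 0 < t) : P {ω | ENNReal.ofReal t ≤ f ω} ≤ ENNReal.ofReal (C / t) := by
  have h1 := (h t.toNNReal).trans hC
  change ENNReal.ofReal t * P {ω | ENNReal.ofReal t ≤ f ω} ≤ _ at h1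
  rwa [ENNReal.ofReal_div_of_pos ht, ENNReal.le_div_iff_mul_le (Or.inl (by simpa))
    (Or.inl ENNReal.ofReal_ne_top), mul_comm]

theorem WeakTail.const_mul (h : WeakTail P f c) (a : ℝ≥0) :
    WeakTail P (fun ω => a * f ω) (a * c) := fun t => by
  rcases eq_or_ne t 0 with rfl | ht
  · simp
  rcases eq_or_ne a 0 with rfl | ha
  · simp [ht]
  have h1 : {ω | (t : ℝ≥0∞) ≤ a * f ω} = {ω | ((t / a : ℝ≥0) : ℝ≥0∞) ≤ f ω} := by
    ext ω
    simp only [Set.mem_ofPred_eq]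
    rw [ENNReal.coe_div ha, ENNReal.div_le_iff_le_mul (Or.inl (by simpa)) (Or.inl (by simp)),
      mul_comm]
  rw [h1]
  calc (t : ℝ≥0∞) * P {ω | ((t / a : ℝ≥0) : ℝ≥0∞) ≤ f ω}
      = a * ((t / a : ℝ≥0) * P {ω | ((t / a : ℝ≥0) : ℝ≥0∞) ≤ f ω}) := by
        rw [← mul_assoc, ← ENNReal.coe_mul, mul_div_cancel₀ _ ha]
    _ ≤ a * c := by gcongr; exact h _

theorem WeakTail.add (hf : WeakTail P f c) (hg : WeakTail P g d) :
    WeakTail P (fun ω => f ω + g ω) (2 * (c + d)) := fun t => by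
  have h1 : {ω | (t : ℝ≥0∞) ≤ f ω + g ω} ⊆
      {ω | ((t / 2 : ℝ≥0) : ℝ≥0∞) ≤ f ω} ∪ {ω | ((t / 2 : ℝ≥0) : ℝ≥0∞) ≤ g ω} := by
    intro ω hω
    by_contra hcon
    simp only [Set.mem_union, Set.mem_ofPred_eq, not_or, not_le] at hcon
    have h2 := ENNReal.add_lt_add hcon.1 hcon.2
    rw [← ENNReal.coe_add, add_halves] at h2
    exact absurd h2 (not_lt.2 hω)
  calc (t : ℝ≥0∞) * P {ω | (t : ℝ≥0∞) ≤ f ω + g ω}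
      ≤ t * (P {ω | ((t / 2 : ℝ≥0) : ℝ≥0∞) ≤ f ω} + P {ω | ((t / 2 : ℝ≥0) : ℝ≥0∞) ≤ g ω}) := by
        gcongr
        exact (measure_mono h1).trans (measure_union_le _ _)
    _ = 2 * ((t / 2 : ℝ≥0) * P {ω | ((t / 2 : ℝ≥0) : ℝ≥0∞) ≤ f ω} +
          (t / 2 : ℝ≥0) * P {ω | ((t / 2 : ℝ≥0) : ℝ≥0∞) ≤ g ω}) := by
        rw [← mul_add, ← mul_assoc]
        congr 1
        rw [show (2 : ℝ≥0∞) = ((2 : ℝ≥0) : ℝ≥0∞) by rfl, ← ENNReal.coe_mul]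
        congr 1
        field_simp
    _ ≤ 2 * (c + d) := by gcongr; exacts [hf _, hg _]

theorem WeakTail.ae_lt_top (h : WeakTail P f c) (hc : c ≠ ∞) : ∀ᵐ ω ∂P, f ω < ∞ := by
  have h1 : ∀ t : ℝ≥0, (t : ℝ≥0∞) * P {ω | ¬ f ω < ∞} ≤ c := fun t => by
    refine le_trans ?_ (h t)
    gcongr with ω
    intro hω
    rw [not_lt_top_iff.1 hω]
    exact le_top
  rw [ae_iff]
  by_contra hne
  have h2 : Tendsto (fun n : ℕ => (n : ℝ≥0∞) * P {ω | ¬ f ω < ∞}) atTop (𝓝 ∞) := by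
    have := ENNReal.Tendsto.mul_const (b := P {ω | ¬ f ω < ∞}) ENNReal.tendsto_nat_nhds_top
      (Or.inl ENNReal.top_ne_zero)
    rwa [ENNReal.top_mul hne] at this
  have h3 := le_of_tendsto' h2 (fun n => by simpa using h1 n)
  exact hc (top_le_iff.1 h3)

/-- A function with a weak tail has a measurable majorant with the same tail. -/
theorem WeakTail.exists_measurable_ge (h : WeakTail P f c) :
    ∃ g : Ω → ℝ≥0∞, Measurable g ∧ (∀ ω, f ω ≤ g ω) ∧ WeakTail P g c := by
  let v : ℚ → ℝ≥0 := fun r => Real.toNNReal r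
  let A : ℚ → Set Ω := fun r => toMeasurable P {ω | (v r : ℝ≥0∞) ≤ f ω}
  -- The measurable hulls `A r` need not be nested. Intersecting over all smaller levels makes the
  -- sets decrease with the level, so a large value of the supremum forces membership in every lower
  -- `A r`.
  let B : ℚ → Set Ω := fun r => ⋂ (s : ℚ) (_ : v s ≤ v r), A s
  have hA : ∀ r, MeasurableSet (A r) := fun r => measurableSet_toMeasurable _ _
  have hB : ∀ r, MeasurableSet (B r) := fun r =>
    MeasurableSet.iInter fun s => MeasurableSet.iInter fun _ => hA s
  refine ⟨fun ω => ⨆ r, (B r).indicator (fun _ => (v r : ℝ≥0∞)) ω,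
    Measurable.iSup fun r => measurable_const.indicator (hB r), fun ω => ?_, fun t => ?_⟩
  · refine le_of_forall_lt fun a ha => ?_
    obtain ⟨r, -, h1, h2⟩ := ENNReal.lt_iff_exists_rat_btwn.1 ha
    refine h1.trans_le (le_trans ?_ (le_iSup _ r))
    rw [Set.indicator_of_mem]
    refine Set.mem_iInter₂.2 fun s hs => subset_toMeasurable _ _ ?_
    exact le_trans (by exact_mod_cast hs) h2.le
  -- The supremum may reach `t` without being attained, so only levels strictly below `t` are
  -- compared with `f`; letting them increase to `t` loses nothing.
  · have key : ∀ r : ℚ, v r < t →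
        (v r : ℝ≥0∞) * P {ω | (t : ℝ≥0∞) ≤ ⨆ r, (B r).indicator (fun _ => (v r : ℝ≥0∞)) ω} ≤ c := by
      intro r hr
      refine le_trans ?_ (h (v r))
      gcongr 1
      rw [← measure_toMeasurable {ω | (v r : ℝ≥0∞) ≤ f ω}]
      refine measure_mono fun ω hω => ?_
      have h1 : (v r : ℝ≥0∞) < ⨆ r, (B r).indicator (fun _ => (v r : ℝ≥0∞)) ω :=
        lt_of_lt_of_le (by exact_mod_cast hr) hω
      obtain ⟨s, hs⟩ := lt_iSup_iff.1 h1
      have hωs : ω ∈ B s := by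
        by_contra hcon
        simp [Set.indicator_of_notMem hcon] at hs
      rw [Set.indicator_of_mem hωs] at hs
      exact Set.mem_iInter₂.1 hωs r (by exact_mod_cast hs.le)
    refine ENNReal.mul_le_of_forall_lt fun a ha b hb => ?_
    obtain ⟨r, -, h1, h2⟩ := ENNReal.lt_iff_exists_rat_btwn.1 ha
    exact (mul_le_mul' h1.le hb.le).trans (key r (by exact_mod_cast h2))

/-- If every `f n` stays below its share `t θ n` of the threshold, the sum stays below `t`; a union
bound over `n` does the rest. -/
theorem WeakTail.tsum {f : ℕ → Ω → ℝ≥0∞} {c : ℕ → ℝ≥0∞} (h : ∀ n, WeakTail P (f n) (c n))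
    {θ : ℕ → ℝ≥0} (hθ : ∀ n, θ n ≠ 0) (hsum : ∑' n, (θ n : ℝ≥0∞) ≤ 1) :
    WeakTail P (fun ω => ∑' n, f n ω) (∑' n, c n / θ n) := fun t => by
  rcases eq_or_ne t 0 with rfl | ht
  · simp
  have h1 : {ω | (t : ℝ≥0∞) ≤ ∑' n, f n ω} ⊆ ⋃ n, {ω | ((t * θ n : ℝ≥0) : ℝ≥0∞) ≤ f n ω} := by
    intro ω hω
    by_contra hcon
    simp only [Set.mem_iUnion, Set.mem_ofPred_eq, not_exists, not_le] at hcon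
    have h2 : ∑' n, ((t * θ n : ℝ≥0) : ℝ≥0∞) ≤ t := by
      simp only [ENNReal.coe_mul]
      rw [ENNReal.tsum_mul_left]
      exact mul_le_of_le_one_right' hsum
    have h3 : ∑' n, f n ω < ∑' n, ((t * θ n : ℝ≥0) : ℝ≥0∞) := by
      refine ENNReal.tsum_lt_tsum ?_ (fun n => (hcon n).le) (hcon 0)
      exact ne_top_of_le_ne_top ENNReal.coe_ne_top
        ((ENNReal.tsum_le_tsum fun n => (hcon n).le).trans h2)
    exact absurd (h3.trans_le h2) (not_lt.2 hω)
  calc (t : ℝ≥0∞) * P {ω | (t : ℝ≥0∞) ≤ ∑' n, f n ω}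
      ≤ t * ∑' n, P {ω | ((t * θ n : ℝ≥0) : ℝ≥0∞) ≤ f n ω} := by
        gcongr
        exact (measure_mono h1).trans (measure_iUnion_le _)
    _ = ∑' n, t * P {ω | ((t * θ n : ℝ≥0) : ℝ≥0∞) ≤ f n ω} := ENNReal.tsum_mul_left.symm
    _ ≤ ∑' n, c n / θ n := by
        refine ENNReal.tsum_le_tsum fun n => ?_
        rw [ENNReal.le_div_iff_mul_le (Or.inl (by simpa using hθ n)) (Or.inl ENNReal.coe_ne_top),
          mul_right_comm, ← ENNReal.coe_mul]
        exact h n _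

theorem WeakTail.tsum_geometric {f : ℕ → Ω → ℝ≥0∞} {A κ : ℝ≥0} (hκ : κ < 1)
    (h : ∀ n, WeakTail P (f n) (A * κ ^ n)) :
    ∃ C : ℝ≥0, ∀ n, WeakTail P (fun ω => ∑' k, f (n + k) ω) (C * κ ^ n) := by
  obtain ⟨ρ, h1, h2⟩ := exists_between hκ
  have hρ : ρ ≠ 0 := (zero_le.trans_lt h1).ne'
  have h1ρ : 1 - ρ ≠ 0 := (tsub_pos_of_lt h2).ne'
  have hfin : (1 - (κ / ρ : ℝ≥0) : ℝ≥0∞)⁻¹ ≠ ∞ := by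
    rw [ENNReal.inv_ne_top, ← ENNReal.coe_one, ← ENNReal.coe_sub]
    have : κ / ρ < 1 := (div_lt_one (pos_iff_ne_zero.2 hρ)).2 h1
    exact ENNReal.coe_ne_zero.2 (tsub_pos_of_lt this).ne'
  refine ⟨A / (1 - ρ) * (1 - (κ / ρ : ℝ≥0) : ℝ≥0∞)⁻¹.toNNReal, fun n => ?_⟩
  -- The shares decay at a rate `ρ` strictly between `κ` and `1`: they sum to one, while the
  -- quotients of constants and shares remain geometric with ratio `κ / ρ`.
  have h3 := WeakTail.tsum (fun k => h (n + k)) (θ := fun k => (1 - ρ) * ρ ^ k)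
    (fun k => mul_ne_zero h1ρ (pow_ne_zero _ hρ)) (by
      simp only [ENNReal.coe_mul, ENNReal.coe_pow]
      rw [ENNReal.tsum_mul_left, ENNReal.tsum_geometric, ENNReal.coe_sub, ENNReal.coe_one]
      exact ENNReal.mul_inv_le_one _)
  refine h3.mono (ae_of_all _ fun _ => le_rfl) (le_of_eq ?_)
  have h4 : ∀ k : ℕ, (A : ℝ≥0∞) * κ ^ (n + k) / ((1 - ρ) * ρ ^ k : ℝ≥0) =
      (A / (1 - ρ) * κ ^ n : ℝ≥0) * ((κ / ρ : ℝ≥0) : ℝ≥0∞) ^ k := fun k => by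
    rw [← ENNReal.coe_pow, ← ENNReal.coe_pow, ← ENNReal.coe_mul, ← ENNReal.coe_mul,
      ← ENNReal.coe_div (mul_ne_zero h1ρ (pow_ne_zero _ hρ))]
    congr 1
    rw [pow_add, div_pow, div_mul_eq_mul_div, div_mul_div_comm]
    ring
  simp only [h4]
  rw [ENNReal.tsum_mul_left, ENNReal.tsum_geometric, ENNReal.coe_mul, ENNReal.coe_mul,
    ENNReal.coe_toNNReal hfin, ENNReal.coe_pow]
  ring

/-- The rescaled functions `ρ⁻ⁿ f n` have tail constants decaying like `(κ / ρ) ^ n`, so their sum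
is almost surely finite. That sum serves as the random constant `C`. -/
theorem WeakTail.ae_le_geometric {f : ℕ → Ω → ℝ≥0∞} {A κ ρ : ℝ≥0} (hκ : κ < ρ)
    (h : ∀ n, WeakTail P (f n) (A * κ ^ n)) :
    ∀ᵐ ω ∂P, ∃ C : ℝ≥0, ∀ n, f n ω ≤ C * (ρ : ℝ≥0∞) ^ n := by
  have hρ : ρ ≠ 0 := (zero_le.trans_lt hκ).ne'
  have h1 : ∀ n, WeakTail P (fun ω => ((ρ⁻¹ ^ n : ℝ≥0) : ℝ≥0∞) * f n ω)
      (A * ((κ / ρ : ℝ≥0) : ℝ≥0∞) ^ n) := fun n => by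
    refine ((h n).const_mul (ρ⁻¹ ^ n)).mono (ae_of_all _ fun _ => le_rfl) (le_of_eq ?_)
    norm_cast
    rw [div_eq_mul_inv, mul_pow]
    ring
  obtain ⟨C, hC⟩ := WeakTail.tsum_geometric
    ((div_lt_one (pos_iff_ne_zero.2 hρ)).2 hκ) h1
  filter_upwards [(hC 0).ae_lt_top (by simp)] with ω hω
  refine ⟨(∑' k, ((ρ⁻¹ ^ (0 + k) : ℝ≥0) : ℝ≥0∞) * f (0 + k) ω).toNNReal, fun n => ?_⟩
  rw [ENNReal.coe_toNNReal hω.ne]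
  have h2 := ENNReal.le_tsum (f := fun k => ((ρ⁻¹ ^ (0 + k) : ℝ≥0) : ℝ≥0∞) * f (0 + k) ω) n
  calc f n ω = ((ρ⁻¹ ^ (0 + n) : ℝ≥0) : ℝ≥0∞) * f (0 + n) ω * (ρ : ℝ≥0∞) ^ n := by
        rw [zero_add, mul_right_comm, ← ENNReal.coe_pow, ← ENNReal.coe_mul, ← mul_pow,
          inv_mul_cancel₀ hρ]
        simp
    _ ≤ _ := by gcongr

theorem exists_linear_mul_pow_le {lam κ : ℝ≥0} (h : lam < κ) (N : ℕ) :
    ∃ C : ℝ≥0, ∀ n : ℕ, ((n * N + 1 : ℕ) : ℝ≥0) * lam ^ n ≤ C * κ ^ n := by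
  have hκ : 0 < (κ : ℝ) := by exact_mod_cast zero_le.trans_lt h
  have hr : |(lam : ℝ) / κ| < 1 := by
    rw [abs_of_nonneg (by positivity), div_lt_one hκ]
    exact_mod_cast h
  have h1 := tendsto_pow_const_mul_const_pow_of_abs_lt_one 1 hr
  have h0 := tendsto_pow_const_mul_const_pow_of_abs_lt_one 0 hr
  obtain ⟨B, hB⟩ := ((h1.const_mul (N : ℝ)).add h0).bddAbove_range
  refine ⟨B.toNNReal, fun n => ?_⟩
  have hn : (N : ℝ) * ((n : ℝ) ^ 1 * ((lam : ℝ) / κ) ^ n) + (n : ℝ) ^ 0 * ((lam : ℝ) / κ) ^ n ≤ B :=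
    hB ⟨n, rfl⟩
  rw [← NNReal.coe_le_coe]
  push_cast
  calc ((n : ℝ) * N + 1) * lam ^ n
      = ((N : ℝ) * ((n : ℝ) ^ 1 * ((lam : ℝ) / κ) ^ n) + (n : ℝ) ^ 0 * ((lam : ℝ) / κ) ^ n)
          * κ ^ n := by
        rw [div_pow]; field_simp
    _ ≤ B.toNNReal * (κ : ℝ) ^ n := by
        gcongr
        exact hn.trans (Real.le_coe_toNNReal B)

end WeakTail

/-! ### Weak tails of weighted sums over the nodes of a given level. -/

section BranchSum

variable {N : ℕ} {X : Type*} [MetricSpace X]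

/-- `∑_{|σ| = n} h (c c_σ) (ω^σ)`, where `c_σ` is the product of the contraction weights
`p_i r_i ^ q` along `σ` and `ω^σ` is the subtree above `σ`. -/
noncomputable def branchSum (q : ℝ) (h : ℝ≥0∞ → ConstructionTree N X → ℝ≥0∞) :
    ℕ → ℝ≥0∞ → ConstructionTree N X → ℝ≥0∞
  | 0, c, ω => h c ω
  | n + 1, c, ω => ∑ i, branchSum q h n (c * (ω []).ratio q i) (subtree ω i)

variable [SecondCountableTopology X] [MeasurableSpace X] [BorelSpace X] {q : ℝ}
  {𝒮 : Measure (ScalingLaw N X)} [IsProbabilityMeasure 𝒮]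

theorem measurable_branchSum {h : ℝ≥0∞ → ConstructionTree N X → ℝ≥0∞}
    (hh : Measurable (Function.uncurry h)) (n : ℕ) :
    Measurable (Function.uncurry (branchSum q h n)) := by
  induction n with
  | zero => exact hh
  | succ n ih =>
    have h1 : Function.uncurry (branchSum q h (n + 1)) = fun z => ∑ i,
        Function.uncurry (branchSum q h n) (z.1 * (z.2 []).ratio q i, subtree z.2 i) := rfl
    rw [h1]
    refine Finset.measurable_sum _ fun i _ => ih.comp (Measurable.prodMk ?_ ?_)
    · exact measurable_fst.mul ((ScalingLaw.measurable_ratio q i).comp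
        ((measurable_pi_apply _).comp measurable_snd))
    · exact (measurable_pi_apply i).comp (measurable_snd.comp (measurable_rootSplit.comp
        measurable_snd))

/-- The root is independent of each subtree, so the inductive bound applies with the root's weight
held fixed. Only a mean bound linear in `c` is needed; `h` itself may be nonlinear in `c`, as the
dyadic truncation is. -/
theorem lintegral_branchSum_le (hq : 0 ≤ q) {lam : ℝ≥0∞}
    (hlam : ∀ᵐ s ∂𝒮, ∑ i, s.ratio q i ≤ lam) {h : ℝ≥0∞ → ConstructionTree N X → ℝ≥0∞}
    (hh : Measurable (Function.uncurry h)) {a : ℝ≥0∞}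
    (ha : ∀ c ≠ ∞, ∫⁻ ω, h c ω ∂treeMeasure 𝒮 ≤ a * c) (n : ℕ) :
    ∀ c ≠ ∞, ∫⁻ ω, branchSum q h n c ω ∂treeMeasure 𝒮 ≤ a * lam ^ n * c := by
  induction n with
  | zero => simpa [branchSum] using ha
  | succ n ih =>
    intro c hc
    have hm := measurable_branchSum (q := q) hh n
    have hm' : ∀ i : Fin N, Measurable fun z : ScalingLaw N X × ConstructionTree N X =>
        branchSum q h n (c * z.1.ratio q i) z.2 := fun i =>
      hm.comp ((((ScalingLaw.measurable_ratio q i).comp measurable_fst).const_mul c).prodMk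
        measurable_snd)
    simp only [branchSum]
    have hcomp : ∀ i : Fin N, Measurable fun ω : ConstructionTree N X =>
        branchSum q h n (c * (ω []).ratio q i) (subtree ω i) := fun i =>
      (hm' i).comp (measurePreserving_rootSplit_apply 𝒮 i).measurable
    rw [lintegral_finsetSum _ fun i _ => hcomp i]
    calc ∑ i, ∫⁻ ω, branchSum q h n (c * (ω []).ratio q i) (subtree ω i) ∂treeMeasure 𝒮
        = ∑ i, ∫⁻ s, ∫⁻ ω, branchSum q h n (c * s.ratio q i) ω ∂treeMeasure 𝒮 ∂𝒮 := by
          refine Finset.sum_congr rfl fun i _ => ?_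
          rw [← lintegral_prod _ (hm' i).aemeasurable]
          exact (measurePreserving_rootSplit_apply 𝒮 i).lintegral_comp (hm' i)
      _ ≤ ∑ i, ∫⁻ s, a * lam ^ n * (c * s.ratio q i) ∂𝒮 := by
          gcongr with i _ s
          exact ih _ (ENNReal.mul_ne_top hc (s.ratio_ne_top hq i))
      _ = ∫⁻ s, a * lam ^ n * c * ∑ i, s.ratio q i ∂𝒮 := by
          rw [← lintegral_finsetSum _ fun i _ =>
            ((ScalingLaw.measurable_ratio q i).const_mul c).const_mul _]
          refine lintegral_congr fun s => ?_
          rw [Finset.mul_sum]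
          exact Finset.sum_congr rfl fun i _ => (mul_assoc _ _ _).symm
      _ ≤ ∫⁻ s, a * lam ^ n * c * lam ∂𝒮 := by
          refine lintegral_mono_ae ?_
          filter_upwards [hlam] with s hs
          gcongr
      _ = a * lam ^ (n + 1) * c := by
          rw [lintegral_const, measure_univ, mul_one, pow_succ]; ring

/-- Dyadic truncation `∑_{k < m} 2⁻ᵏ 1{x ≥ t 2⁻⁽ᵏ⁺¹⁾}`. -/
noncomputable def dyadicSum (t : ℝ≥0∞) (m : ℕ) (x : ℝ≥0∞) : ℝ≥0∞ :=
  ∑ k ∈ Finset.range m, 2⁻¹ ^ k * (Set.Ici (t * 2⁻¹ ^ (k + 1))).indicator 1 x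

theorem measurable_dyadicSum (t : ℝ≥0∞) (m : ℕ) : Measurable (dyadicSum t m) :=
  Finset.measurable_sum _ fun _ _ => (measurable_one.indicator measurableSet_Ici).const_mul _

/-- Adding layer `m` halves the remainder: either `x` reaches `t 2⁻⁽ᵐ⁺¹⁾` and the new term pays the
whole previous remainder, or `x` is already below the new one. -/
theorem min_le_dyadicSum (t : ℝ≥0∞) (m : ℕ) (x : ℝ≥0∞) :
    min t x ≤ t * 2⁻¹ ^ m + t * dyadicSum t m x := by
  induction m with
  | zero => simp [dyadicSum]
  | succ m ih =>
    by_cases hx : t * 2⁻¹ ^ (m + 1) ≤ x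
    · rw [dyadicSum, Finset.sum_range_succ, ← dyadicSum, Set.indicator_of_mem (Set.mem_Ici.2 hx)]
      refine ih.trans ?_
      simp only [Pi.one_apply, mul_one]
      rw [mul_add, add_comm (t * dyadicSum t m x)]
      exact add_le_add_left le_add_self _ |>.trans (by rw [add_assoc])
    · exact (min_le_right _ _).trans ((not_le.1 hx).le.trans le_self_add)

theorem min_sum_le {ι : Type*} (s : Finset ι) (t : ℝ≥0∞) (f : ι → ℝ≥0∞) :
    min t (∑ i ∈ s, f i) ≤ ∑ i ∈ s, min t (f i) := by
  classical
  induction s using Finset.induction_on with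
  | empty => simp
  | insert i s hi ih =>
    rw [Finset.sum_insert hi, Finset.sum_insert hi]
    refine le_trans ?_ (add_le_add_right ih _)
    rcases le_total t (f i) with h | h
    · rw [min_eq_left h]; exact (min_le_left _ _).trans le_self_add
    rw [min_eq_right h]
    rcases le_total t (∑ i ∈ s, f i) with h' | h'
    · rw [min_eq_left h']; exact (min_le_left _ _).trans le_add_self
    · rw [min_eq_right h']; exact min_le_right _ _

omit [SecondCountableTopology X] [MeasurableSpace X] [BorelSpace X] in
theorem min_branchSum_le (Z : ConstructionTree N X → ℝ≥0∞) (t : ℝ≥0∞) (m n : ℕ) (c : ℝ≥0∞)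
    (ω : ConstructionTree N X) :
    min t (branchSum q (fun c ω => c * Z ω) n c ω) ≤ N ^ n * (t * 2⁻¹ ^ m) +
      t * branchSum q (fun c ω => dyadicSum t m (c * Z ω)) n c ω := by
  induction n generalizing c ω with
  | zero => simpa [branchSum] using min_le_dyadicSum t m (c * Z ω)
  | succ n ih =>
    simp only [branchSum]
    refine (min_sum_le _ _ _).trans ((Finset.sum_le_sum fun i _ => ih _ _).trans_eq ?_)
    rw [Finset.sum_add_distrib, Finset.mul_sum]
    simp only [Finset.sum_const, Finset.card_univ, Fintype.card_fin, nsmul_eq_mul]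
    rw [pow_succ]
    ring

-- Layer `k` contributes at most `2⁻ᵏ · cγ / (t 2⁻⁽ᵏ⁺¹⁾) = 2γc / t`, the same for all `k`. The
-- factor `m` is the logarithmic loss of truncated weak `L¹` means.
omit [SecondCountableTopology X] [BorelSpace X] [IsProbabilityMeasure 𝒮] in
theorem lintegral_dyadicSum_le {Z : ConstructionTree N X → ℝ≥0∞} (hZ : Measurable Z) {γ : ℝ≥0∞}
    (hγ : WeakTail (treeMeasure 𝒮) Z γ) {t : ℝ≥0} (ht : t ≠ 0) (m : ℕ) :
    ∀ c ≠ ∞, ∫⁻ ω, dyadicSum t m (c * Z ω) ∂treeMeasure 𝒮 ≤ m * (2 * γ / t) * c := by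
  intro c hc
  lift c to ℝ≥0 using hc
  simp only [dyadicSum]
  have hms : ∀ k : ℕ, MeasurableSet {ω | (t : ℝ≥0∞) * 2⁻¹ ^ (k + 1) ≤ c * Z ω} := fun k =>
    measurableSet_le measurable_const (hZ.const_mul _)
  have hind : ∀ (k : ℕ) ω, (Set.Ici ((t : ℝ≥0∞) * 2⁻¹ ^ (k + 1))).indicator
      (1 : ℝ≥0∞ → ℝ≥0∞) (c * Z ω) =
        {ω | (t : ℝ≥0∞) * 2⁻¹ ^ (k + 1) ≤ c * Z ω}.indicator 1 ω := fun k ω => rfl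
  simp only [hind]
  rw [lintegral_finsetSum _ fun k _ => (measurable_one.indicator (hms k)).const_mul _]
  have hk : ∀ k ∈ Finset.range m, ∫⁻ ω, 2⁻¹ ^ k *
      {ω | (t : ℝ≥0∞) * 2⁻¹ ^ (k + 1) ≤ c * Z ω}.indicator 1 ω ∂treeMeasure 𝒮 ≤
        2 * γ / t * c := by
    intro k _
    rw [lintegral_const_mul _ (measurable_one.indicator (hms k)), lintegral_indicator_one (hms k)]
    have h1 := hγ.const_mul c (t * 2⁻¹ ^ (k + 1))
    have h2 : ((t * 2⁻¹ ^ (k + 1) : ℝ≥0) : ℝ≥0∞) = t * 2⁻¹ ^ (k + 1) := by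
      push_cast
      rfl
    rw [h2] at h1
    have h3 : 2 * γ / t * c = 2 * (c * γ) / t := by
      simp only [div_eq_mul_inv]; ring
    rw [h3, ENNReal.le_div_iff_mul_le (Or.inl (by simpa)) (Or.inl ENNReal.coe_ne_top)]
    calc _ = 2 * (t * 2⁻¹ ^ (k + 1) *
          (treeMeasure 𝒮) {ω | (t : ℝ≥0∞) * 2⁻¹ ^ (k + 1) ≤ c * Z ω}) := by
          rw [pow_succ]
          have : (2 : ℝ≥0∞) * 2⁻¹ = 1 := ENNReal.mul_inv_cancel two_ne_zero ENNReal.ofNat_ne_top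
          calc _ = 1 * (2⁻¹ ^ k *
            (treeMeasure 𝒮) {ω | (t : ℝ≥0∞) * (2⁻¹ ^ k * 2⁻¹) ≤ c * Z ω} * t) := by rw [one_mul]
            _ = _ := by rw [← this]; ring
      _ ≤ 2 * (c * γ) := by gcongr
  refine (Finset.sum_le_sum hk).trans_eq ?_
  simp only [Finset.sum_const, Finset.card_range, nsmul_eq_mul]
  ring

/-- If the branch sum reaches `t`, the dyadic sums over the branches reach `1/2`, because the
truncation remainders total at most `t / 2`. Markov's inequality at level `1/2` and the mean bound
`2mγλⁿ / t` give the constant `4γmλⁿ`. -/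
theorem weakTail_branchSum (hq : 0 ≤ q) {lam : ℝ≥0∞} (hlam : ∀ᵐ s ∂𝒮, ∑ i, s.ratio q i ≤ lam)
    {Z : ConstructionTree N X → ℝ≥0∞} (hZ : Measurable Z) {γ : ℝ≥0∞}
    (hγ : WeakTail (treeMeasure 𝒮) Z γ) (n : ℕ) :
    WeakTail (treeMeasure 𝒮) (branchSum q (fun c ω => c * Z ω) n 1)
      (4 * γ * ((n * N + 1 : ℕ) * lam ^ n)) := fun t => by
  rcases eq_or_ne t 0 with rfl | ht
  · simp
  -- Since `N ≤ 2 ^ N`, this many layers bring the remainders of all `N ^ n` nodes to at most half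
  -- of `t`, while `m` stays linear in `n`.
  set m := n * N + 1 with hm
  have hN : (N : ℝ≥0∞) ^ n * 2⁻¹ ^ m ≤ 2⁻¹ := by
    have h1 : N ^ n ≤ 2 ^ (n * N) := by
      rw [mul_comm, pow_mul]
      exact Nat.pow_le_pow_left N.lt_two_pow_self.le n
    have h2 : (N : ℝ≥0∞) ^ n ≤ 2 ^ (n * N) := by exact_mod_cast h1
    calc (N : ℝ≥0∞) ^ n * 2⁻¹ ^ m ≤ 2 ^ (n * N) * 2⁻¹ ^ m := by gcongr
      _ = 2⁻¹ := by
        rw [hm, pow_succ, ← mul_assoc, ← mul_pow,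
          ENNReal.mul_inv_cancel two_ne_zero ENNReal.ofNat_ne_top, one_pow, one_mul]
  have hh : Measurable (Function.uncurry fun (c : ℝ≥0∞) (ω : ConstructionTree N X) =>
      dyadicSum t m (c * Z ω)) :=
    (measurable_dyadicSum _ _).comp (measurable_fst.mul (hZ.comp measurable_snd))
  have hsub : {ω | (t : ℝ≥0∞) ≤ branchSum q (fun c ω => c * Z ω) n 1 ω} ⊆
      {ω | 2⁻¹ ≤ branchSum q (fun c ω => dyadicSum t m (c * Z ω)) n 1 ω} := by
    intro ω hω
    have h1 := min_branchSum_le (q := q) Z t m n 1 ω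
    rw [min_eq_left hω] at h1
    by_contra hcon
    rw [Set.mem_ofPred_eq, not_le] at hcon
    have ht0 : (t : ℝ≥0∞) ≠ 0 := by simpa using ht
    have h2 : (t : ℝ≥0∞) < t := by
      calc (t : ℝ≥0∞) ≤ N ^ n * (t * 2⁻¹ ^ m) +
            t * branchSum q (fun c ω => dyadicSum t m (c * Z ω)) n 1 ω := h1
        _ = t * (N ^ n * 2⁻¹ ^ m) +
            t * branchSum q (fun c ω => dyadicSum t m (c * Z ω)) n 1 ω := by ring
        _ < t * 2⁻¹ + t * 2⁻¹ := by
          refine ENNReal.add_lt_add_of_le_of_lt ?_ (by gcongr) ?_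
          · exact ne_top_of_le_ne_top (b := t * 2⁻¹)
              (ENNReal.mul_ne_top ENNReal.coe_ne_top (by simp)) (by gcongr)
          · exact ENNReal.mul_lt_mul_right ht0 ENNReal.coe_ne_top hcon
        _ = t := by rw [← mul_add, ENNReal.inv_two_add_inv_two, mul_one]
    exact lt_irrefl _ h2
  have hint := lintegral_branchSum_le hq hlam hh (lintegral_dyadicSum_le hZ hγ ht m) n 1
    ENNReal.one_ne_top
  have hmar := mul_meas_ge_le_lintegral (μ := treeMeasure 𝒮)
    ((measurable_branchSum (q := q) hh n).comp (measurable_prodMk_left (x := (1 : ℝ≥0∞)))) 2⁻¹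
  have h2 : (2 : ℝ≥0∞) * 2⁻¹ = 1 := ENNReal.mul_inv_cancel two_ne_zero ENNReal.ofNat_ne_top
  have h3 : (t : ℝ≥0∞) * (t : ℝ≥0∞)⁻¹ = 1 :=
    ENNReal.mul_inv_cancel (by simpa) ENNReal.coe_ne_top
  calc (t : ℝ≥0∞) * treeMeasure 𝒮 {ω | (t : ℝ≥0∞) ≤ branchSum q (fun c ω => c * Z ω) n 1 ω}
      ≤ t * treeMeasure 𝒮 {ω | 2⁻¹ ≤ branchSum q (fun c ω => dyadicSum t m (c * Z ω)) n 1 ω} := by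
        gcongr 1
        exact measure_mono hsub
    _ = t * 2 * (2⁻¹ *
          treeMeasure 𝒮 {ω | 2⁻¹ ≤ branchSum q (fun c ω => dyadicSum t m (c * Z ω)) n 1 ω}) := by
        rw [← mul_assoc, mul_assoc _ 2, h2, mul_one]
    _ ≤ t * 2 * (m * (2 * γ / t) * lam ^ n * 1) := by
        gcongr 1
        exact hmar.trans hint
    _ = (t * (t : ℝ≥0∞)⁻¹) * (4 * γ * (m * lam ^ n)) := by
        rw [div_eq_mul_inv]; ring
    _ = 4 * γ * (m * lam ^ n) := by rw [h3, one_mul]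

/-- Weak tails decay geometrically under iteration of a weighted recursion on the tree. -/
theorem exists_weakTail_geometric (hq : 0 ≤ q) {lam κ : ℝ≥0} (hκ : lam < κ)
    (hlam : ∀ᵐ s ∂𝒮, ∑ i, s.ratio q i ≤ (lam : ℝ≥0∞)) {Y : ℕ → ConstructionTree N X → ℝ≥0∞} {γ : ℝ≥0}
    (h0 : WeakTail (treeMeasure 𝒮) (Y 0) γ)
    (hstep : ∀ n, ∀ᵐ ω ∂treeMeasure 𝒮,
      Y (n + 1) ω ≤ ∑ i, (ω []).ratio q i * Y n (subtree ω i)) :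
    ∃ A : ℝ≥0, ∀ n, WeakTail (treeMeasure 𝒮) (Y n) (A * κ ^ n) := by
  -- `Y 0` is not assumed measurable, whereas the mean estimates require it; the majorant `Z` has
  -- the same tail constant.
  obtain ⟨Z, hZ, hYZ, hZγ⟩ := h0.exists_measurable_ge
  -- The quantifier over `c` stands inside the almost sure event, since the induction uses the
  -- random value `c * ratio` taken from the root.
  have hle : ∀ n, ∀ᵐ ω ∂treeMeasure 𝒮, ∀ c,
      c * Y n ω ≤ branchSum q (fun c ω => c * Z ω) n c ω := by
    intro n
    induction n with
    | zero => exact ae_of_all _ fun ω c => mul_le_mul_right (hYZ ω) c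
    | succ n ih =>
      filter_upwards [hstep n, ae_forall_subtree ih] with ω h1 h2 c
      refine (mul_le_mul_right h1 c).trans ?_
      rw [Finset.mul_sum]
      refine Finset.sum_le_sum fun i _ => ?_
      rw [← mul_assoc]
      exact h2 i _
  obtain ⟨C, hC⟩ := exists_linear_mul_pow_le hκ N
  refine ⟨4 * γ * C, fun n => ?_⟩
  refine (weakTail_branchSum hq hlam hZ hZγ n).mono ?_ ?_
  · filter_upwards [hle n] with ω hω
    simpa using hω 1
  · have := hC n
    calc 4 * (γ : ℝ≥0∞) * ((n * N + 1 : ℕ) * (lam : ℝ≥0∞) ^ n)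
        = 4 * (γ : ℝ≥0∞) * (((n * N + 1 : ℕ) : ℝ≥0) * lam ^ n : ℝ≥0) := by
          push_cast; rfl
      _ ≤ 4 * (γ : ℝ≥0∞) * (C * κ ^ n : ℝ≥0) := by gcongr
      _ = _ := by push_cast; ring

end BranchSum

/-! ### Test functions separate measures and detect measurability. -/

section TestFunction

variable {X : Type*} [MetricSpace X] [MeasurableSpace X] {q : ℝ}

/-- Bounded measurable real functions that are Lipschitz for the metric `d ^ q`. -/
def IsTestFunction (q : ℝ) (f : X → ℝ) : Prop :=
  Measurable f ∧ (∃ C : ℝ, ∀ x, |f x| ≤ C) ∧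
    ∃ u : ℝ≥0, ∀ x y, edist (f x) (f y) ≤ u * edist x y ^ q

theorem IsTestFunction.exists_ne_zero {f : X → ℝ} (hf : IsTestFunction q f) :
    ∃ u : ℝ≥0, u ≠ 0 ∧ ∀ x y, edist (f x) (f y) ≤ u * edist x y ^ q := by
  obtain ⟨u, hu⟩ := hf.2.2
  refine ⟨u + 1, by positivity, fun x y => (hu x y).trans ?_⟩
  gcongr
  exact le_self_add

theorem isTestFunction_zero : IsTestFunction q (fun _ : X => (0 : ℝ)) :=
  ⟨measurable_const, ⟨0, by simp⟩, 0, by simp⟩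

theorem IsTestFunction.add {f g : X → ℝ} (hf : IsTestFunction q f) (hg : IsTestFunction q g) :
    IsTestFunction q fun x => f x + g x := by
  obtain ⟨hfm, ⟨C, hC⟩, u, hu⟩ := hf
  obtain ⟨hgm, ⟨D, hD⟩, v, hv⟩ := hg
  refine ⟨hfm.add hgm, ⟨C + D, fun x => (abs_add_le _ _).trans (add_le_add (hC x) (hD x))⟩,
    u + v, fun x y => ?_⟩
  calc edist (f x + g x) (f y + g y) ≤ edist (f x) (f y) + edist (g x) (g y) :=
        edist_add_add_le _ _ _ _
    _ ≤ u * edist x y ^ q + v * edist x y ^ q := add_le_add (hu x y) (hv x y)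
    _ = (u + v : ℝ≥0) * edist x y ^ q := by push_cast; ring

theorem IsTestFunction.const_mul {f : X → ℝ} (hf : IsTestFunction q f) (c : ℝ) :
    IsTestFunction q fun x => c * f x := by
  obtain ⟨hfm, ⟨C, hC⟩, u, hu⟩ := hf
  refine ⟨hfm.const_mul c, ⟨|c| * C, fun x => ?_⟩, ‖c‖₊ * u, fun x y => ?_⟩
  · rw [abs_mul]
    exact mul_le_mul_of_nonneg_left (hC x) (abs_nonneg c)
  · calc edist (c * f x) (c * f y) = ‖c‖₊ * edist (f x) (f y) := by
          rw [edist_eq_enorm_sub, edist_eq_enorm_sub, ← mul_sub, enorm_mul]; rfl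
      _ ≤ ‖c‖₊ * (u * edist x y ^ q) := by gcongr; exact hu x y
      _ = _ := by push_cast; ring

theorem IsTestFunction.sum {ι : Type*} (s : Finset ι) {f : ι → X → ℝ} (c : ι → ℝ)
    (hf : ∀ i, IsTestFunction q (f i)) : IsTestFunction q fun x => ∑ i ∈ s, c i * f i x := by
  classical
  induction s using Finset.induction_on with
  | empty => simpa using isTestFunction_zero
  | insert i s hi ih =>
    simp only [Finset.sum_insert hi]
    exact ((hf i).const_mul (c i)).add ih

theorem IsTestFunction.integrable {f : X → ℝ} (hf : IsTestFunction q f) (m : Measure X)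
    [IsFiniteMeasure m] : Integrable f m := by
  obtain ⟨hfm, ⟨C, hC⟩, -⟩ := hf
  exact Integrable.of_bound hfm.aestronglyMeasurable C (ae_of_all _ hC)

theorem IsTestFunction.measurable_integral {f : X → ℝ} (hf : IsTestFunction q f) :
    Measurable fun m : FiniteMeasure X => ∫ x, f x ∂(m : Measure X) := by
  obtain ⟨hfm, ⟨C, hC⟩, -⟩ := hf
  exact measurable_integral_finiteMeasure hfm hC

theorem min_one_le_rpow (hq : 0 < q) (hq1 : q ≤ 1) (t : ℝ≥0∞) : min 1 t ≤ t ^ q := by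
  rcases le_total t 1 with h | h
  · rw [min_eq_right h]
    simpa using ENNReal.rpow_le_rpow_of_exponent_ge h hq1
  · rw [min_eq_left h]
    exact ENNReal.one_le_rpow h hq

variable [BorelSpace X]

/-- A function with oscillation at most one and Lipschitz constant `1/δ` has modulus `min 1 (d/δ) ≤
(d/δ) ^ q`, so ordinary Lipschitz cut-offs also serve for the metric `d ^ q`. -/
theorem isTestFunction_thickenedIndicator (hq : 0 < q) (hq1 : q ≤ 1) {δ : ℝ} (hδ : 0 < δ)
    (F : Set X) : IsTestFunction q fun x => (thickenedIndicator hδ F x : ℝ) := by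
  have h1 : ∀ x, thickenedIndicator hδ F x ≤ 1 := thickenedIndicator_le_one hδ F
  have hL := lipschitzWith_thickenedIndicator hδ F
  refine ⟨(NNReal.continuous_coe.comp (thickenedIndicator hδ F).continuous).measurable,
    ⟨1, fun x => by simpa using h1 x⟩, (δ.toNNReal⁻¹) ^ q, fun x y => ?_⟩
  have h2 : edist (thickenedIndicator hδ F x : ℝ) (thickenedIndicator hδ F y : ℝ) ≤ 1 := by
    rw [edist_dist, Real.dist_eq]
    refine ENNReal.ofReal_le_one.2 (abs_le.2 ⟨?_, ?_⟩)
    · have := h1 y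
      have : ((thickenedIndicator hδ F y : ℝ≥0) : ℝ) ≤ 1 := by exact_mod_cast this
      have := (thickenedIndicator hδ F x).coe_nonneg
      linarith
    · have := h1 x
      have : ((thickenedIndicator hδ F x : ℝ≥0) : ℝ) ≤ 1 := by exact_mod_cast this
      have := (thickenedIndicator hδ F y).coe_nonneg
      linarith
  have h3 : edist (thickenedIndicator hδ F x : ℝ) (thickenedIndicator hδ F y : ℝ) ≤
      (δ.toNNReal⁻¹ : ℝ≥0) * edist x y := hL x y
  rw [ENNReal.coe_rpow_of_nonneg _ hq.le, ← ENNReal.mul_rpow_of_nonneg _ _ hq.le]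
  exact (le_min h2 h3).trans (min_one_le_rpow hq hq1 _)

theorem exists_testFunction_tendsto (hq : 0 < q) (hq1 : q ≤ 1) {F : Set X} (hF : IsClosed F) :
    ∃ f : ℕ → X → ℝ, (∀ k, IsTestFunction q (f k)) ∧ ∀ m : FiniteMeasure X,
      Tendsto (fun k => ∫ x, f k x ∂(m : Measure X)) atTop (𝓝 ((m : Measure X).real F)) := by
  have hpos : ∀ k : ℕ, 0 < (1 : ℝ) / (k + 1) := fun k => by positivity
  exact ⟨fun k x => thickenedIndicator (hpos k) F x,
    fun k => isTestFunction_thickenedIndicator hq hq1 (hpos k) F,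
    fun m => tendsto_integral_thickenedIndicator_of_isClosed _ hF hpos
      tendsto_one_div_add_atTop_nhds_zero_nat⟩

theorem ext_of_testFunction (hq : 0 < q) (hq1 : q ≤ 1) {μ ν : FiniteMeasure X}
    (h : ∀ f : X → ℝ, IsTestFunction q f →
      ∫ x, f x ∂(μ : Measure X) = ∫ x, f x ∂(ν : Measure X)) : μ = ν := by
  have hcl : ∀ F : Set X, IsClosed F → (μ : Measure X) F = (ν : Measure X) F := by
    intro F hF
    obtain ⟨f, hf, hlim⟩ := exists_testFunction_tendsto (q := q) hq hq1 hF
    have h1 := hlim μ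
    simp only [h _ (hf _)] at h1
    exact (measureReal_eq_measureReal_iff).1 (tendsto_nhds_unique h1 (hlim ν))
  refine FiniteMeasure.toMeasure_injective (ext_of_generate_finite {s | IsClosed s}
    (by rw [BorelSpace.measurable_eq (α := X), borel_eq_generateFrom_isClosed])
    isPiSystem_isClosed (fun s hs => hcl s hs) (hcl _ isClosed_univ))

/-- Masses of closed sets are limits of integrals of test functions, and closed sets form a
generating π-system. -/
theorem measurable_of_measurable_integral (hq : 0 < q) (hq1 : q ≤ 1) {Ω : Type*}
    [MeasurableSpace Ω] {ν : Ω → FiniteMeasure X}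
    (h : ∀ f : X → ℝ, IsTestFunction q f →
      Measurable fun ω => ∫ x, f x ∂(ν ω : Measure X)) : Measurable ν := by
  have hcl : ∀ F : Set X, IsClosed F → Measurable fun ω => (ν ω : Measure X) F := by
    intro F hF
    obtain ⟨f, hf, hlim⟩ := exists_testFunction_tendsto (q := q) hq hq1 hF
    have h2 : Measurable fun ω => (ν ω : Measure X).real F :=
      measurable_of_tendsto_metrizable (fun k => h _ (hf k)) (tendsto_pi_nhds.2 fun ω => hlim _)
    have h3 := h2.ennreal_ofReal
    simpa only [Measure.real, ENNReal.ofReal_toReal (measure_ne_top _ _)] using h3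
  exact Measurable.subtype_mk (f := fun ω => (ν ω : Measure X))
    (Measurable.measure_of_isPiSystem (S := {s | IsClosed s})
      (by rw [BorelSpace.measurable_eq (α := X), borel_eq_generateFrom_isClosed])
      isPiSystem_isClosed (fun s hs => hcl s hs) (hcl _ isClosed_univ))

theorem measurable_of_tendsto_integral (hq : 0 < q) (hq1 : q ≤ 1) {Ω : Type*} [MeasurableSpace Ω]
    {μ : ℕ → Ω → FiniteMeasure X} (hμ : ∀ n, Measurable (μ n)) {ν : Ω → FiniteMeasure X}
    (h : ∀ f : X → ℝ, IsTestFunction q f → ∀ ω, Tendsto (fun n => ∫ x, f x ∂(μ n ω : Measure X))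
      atTop (𝓝 (∫ x, f x ∂(ν ω : Measure X)))) : Measurable ν :=
  measurable_of_measurable_integral hq hq1 fun f hf =>
    measurable_of_tendsto_metrizable (fun n => hf.measurable_integral.comp (hμ n))
      (tendsto_pi_nhds.2 fun ω => h f hf ω)

variable [SecondCountableTopology X]

theorem IsTestFunction.tendsto_integral (hq : 0 < q) (hq1 : q ≤ 1) {f : X → ℝ}
    (hf : IsTestFunction q f) {μ : ℕ → FiniteMeasure X} {ν : FiniteMeasure X}
    (h : Tendsto (fun n => minimalMetric q (μ n) ν) atTop (𝓝 0)) :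
    Tendsto (fun n => ∫ x, f x ∂(μ n : Measure X)) atTop (𝓝 (∫ x, f x ∂(ν : Measure X))) := by
  obtain ⟨u, hu0, hu⟩ := hf.exists_ne_zero
  obtain ⟨hfm, ⟨C, hC⟩, -⟩ := hf
  rw [tendsto_iff_edist_tendsto_0]
  refine tendsto_of_tendsto_of_tendsto_of_le_of_le tendsto_const_nhds ?_ (fun _ => zero_le)
    fun n => edist_integral_le_minimalMetric hq hq1 hfm hC hu0 hu
  simpa using ENNReal.Tendsto.const_mul h (Or.inr (ENNReal.coe_ne_top (r := u)))

theorem eq_of_tendsto_minimalMetric (hq : 0 < q) (hq1 : q ≤ 1) {μ : ℕ → FiniteMeasure X}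
    {ν ν' : FiniteMeasure X} (h : Tendsto (fun n => minimalMetric q (μ n) ν) atTop (𝓝 0))
    (h' : Tendsto (fun n => minimalMetric q (μ n) ν') atTop (𝓝 0)) : ν = ν' :=
  ext_of_testFunction hq hq1 fun _ hf =>
    tendsto_nhds_unique (hf.tendsto_integral hq hq1 h) (hf.tendsto_integral hq hq1 h')

theorem minimalMetric_comm_le (hq : 0 < q) (hq1 : q ≤ 1) (μ ν : FiniteMeasure X) :
    minimalMetric q μ ν ≤ minimalMetric q ν μ := by
  rw [minimalMetric_eq_iInf hq hq1 ν μ]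
  refine le_iInf₂ fun π hπ => ?_
  have h : IsCoupling (π.map Prod.swap) (μ : Measure X) ν := by
    constructor
    · rw [Measure.map_map measurable_fst measurable_swap]; exact hπ.2
    · rw [Measure.map_map measurable_snd measurable_swap]; exact hπ.1
  refine (minimalMetric_le_lintegral hq hq1 h).trans_eq ?_
  rw [lintegral_map measurable_edist_rpow measurable_swap]
  simp only [Prod.fst_swap, Prod.snd_swap, edist_comm]

end TestFunction

/-! ### The invariant random measure and the convergence of iterates. -/

section FixedPoint

variable {N : ℕ} {X : Type*} [MetricSpace X] [SecondCountableTopology X] [MeasurableSpace X]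
  [BorelSpace X] {q : ℝ} {𝒮 : Measure (ScalingLaw N X)} [IsProbabilityMeasure 𝒮]

theorem ae_minimalMetric_treeApply_le (hq : 0 < q) (hq1 : q ≤ 1)
    {μ ν : ConstructionTree N X → FiniteMeasure X} (hμ : ∀ᵐ ω ∂treeMeasure 𝒮, (μ ω).mass = 1)
    (hν : ∀ᵐ ω ∂treeMeasure 𝒮, (ν ω).mass = 1) :
    ∀ᵐ ω ∂treeMeasure 𝒮, minimalMetric q (treeApply μ ω) (treeApply ν ω) ≤
      ∑ i, (ω []).ratio q i * minimalMetric q (μ (subtree ω i)) (ν (subtree ω i)) := by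
  filter_upwards [ae_forall_subtree hμ, ae_forall_subtree hν] with ω h1 h2
  exact minimalMetric_combine_le hq hq1 _ h1 h2

theorem exists_weakTail_iterate (hsum : ∀ᵐ s ∂𝒮, ∑ i, s.weight i = 1) (hq : 0 < q) (hq1 : q ≤ 1)
    {lam κ : ℝ≥0} (hκ : lam < κ) (hlam : ∀ᵐ s ∂𝒮, ∑ i, s.ratio q i ≤ (lam : ℝ≥0∞))
    {μ ν : ConstructionTree N X → FiniteMeasure X} (hμ : ∀ᵐ ω ∂treeMeasure 𝒮, (μ ω).mass = 1)
    (hν : ∀ᵐ ω ∂treeMeasure 𝒮, (ν ω).mass = 1) {γ : ℝ≥0}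
    (h : WeakTail (treeMeasure 𝒮) (fun ω => minimalMetric q (μ ω) (ν ω)) γ) :
    ∃ A : ℝ≥0, ∀ n, WeakTail (treeMeasure 𝒮)
      (fun ω => minimalMetric q (treeApply^[n] μ ω) (treeApply^[n] ν ω)) (A * κ ^ n) := by
  refine exists_weakTail_geometric (q := q) hq.le hκ hlam
    (Y := fun n ω => minimalMetric q (treeApply^[n] μ ω) (treeApply^[n] ν ω)) h fun n => ?_
  simp only [Function.iterate_succ_apply']
  exact ae_minimalMetric_treeApply_le hq hq1 (ae_mass_iterate_treeApply hsum hμ n)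
    (ae_mass_iterate_treeApply hsum hν n)

/-- The limits are chosen separately for each `ω`, with no measurable selection. Measurability is
recovered afterwards, because integrals of test functions against the limit are pointwise limits of
measurable functions. -/
theorem exists_measurable_limit [CompleteSpace X] (hq : 0 < q) (hq1 : q ≤ 1) {Ω : Type*}
    [MeasurableSpace Ω] {P : Measure Ω} {μ : ℕ → Ω → FiniteMeasure X}
    (hμ : ∀ n, Measurable (μ n)) (hmass : ∀ n, ∀ᵐ ω ∂P, (μ n ω).mass = 1)
    (hfin : ∀ᵐ ω ∂P, ∑' n, minimalMetric q (μ n ω) (μ (n + 1) ω) < ∞) :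
    ∃ ν : Ω → FiniteMeasure X, Measurable ν ∧ (∀ᵐ ω ∂P, (ν ω).mass = 1) ∧
      (∀ᵐ ω ∂P, ∀ n, minimalMetric q (μ n ω) (ν ω) ≤
        ∑' k, minimalMetric q (μ (n + k) ω) (μ (n + k + 1) ω)) ∧
      ∀ᵐ ω ∂P, Tendsto (fun n => minimalMetric q (μ n ω) (ν ω)) atTop (𝓝 0) := by
  classical
  have hgood : ∀ᵐ ω ∂P, (∀ n, (μ n ω).mass = 1) ∧
      ∑' n, minimalMetric q (μ n ω) (μ (n + 1) ω) < ∞ := (ae_all_iff.2 hmass).and hfin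
  obtain ⟨G, hG, hGm, hGP⟩ := hgood.exists_measurable_mem
  have hex : ∀ ω, ∃ ν : FiniteMeasure X, ω ∈ G → ν.mass = 1 ∧
      ∀ n, minimalMetric q (μ n ω) ν ≤
        ∑' k, minimalMetric q (μ (n + k) ω) (μ (n + k + 1) ω) := by
    intro ω
    by_cases hω : ω ∈ G
    · obtain ⟨ν, h⟩ := exists_limit_minimalMetric hq hq1 (hGP ω hω).1 (hGP ω hω).2.ne
      exact ⟨ν, fun _ => h⟩
    · exact ⟨0, fun h => absurd h hω⟩
  choose ν hν using hex
  have hlim : ∀ ω ∈ G, Tendsto (fun n => minimalMetric q (μ n ω) (ν ω)) atTop (𝓝 0) := by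
    intro ω hω
    refine tendsto_of_tendsto_of_tendsto_of_le_of_le tendsto_const_nhds ?_ (fun _ => zero_le)
      (hν ω hω).2
    refine (ENNReal.tendsto_sum_nat_add _ (hGP ω hω).2.ne).congr fun n => ?_
    exact tsum_congr fun k => by rw [add_comm k n]
  let ν' : Ω → FiniteMeasure X := fun ω => if ω ∈ G then ν ω else 0
  have hν' : ∀ ω ∈ G, ν' ω = ν ω := fun ω hω => if_pos hω
  refine ⟨ν', ?_, ?_, ?_, ?_⟩
  · refine measurable_of_tendsto_integral (q := q) hq hq1
      (μ := fun n ω => if ω ∈ G then μ n ω else 0)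
      (fun n => Measurable.ite hGm (hμ n) measurable_const) fun f hf ω => ?_
    by_cases hω : ω ∈ G
    · simp only [ν', hω, if_true]
      exact hf.tendsto_integral hq hq1 (hlim ω hω)
    · simp only [ν', hω, if_false]
      exact tendsto_const_nhds
  · filter_upwards [hG] with ω hω
    rw [hν' ω hω]; exact (hν ω hω).1
  · filter_upwards [hG] with ω hω
    rw [hν' ω hω]; exact (hν ω hω).2
  · filter_upwards [hG] with ω hω
    rw [hν' ω hω]; exact hlim ω hω

/-- Existence of the self-similar random measure and exponential convergence of the iterates, for
exponents at most one. -/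
theorem exists_fixedPoint [CompleteSpace X] (hsum : ∀ᵐ s ∂𝒮, ∑ i, s.weight i = 1) (hq : 0 < q)
    (hq1 : q ≤ 1) {lam : ℝ≥0} (hlam1 : lam < 1)
    (hlam : ∀ᵐ s ∂𝒮, ∑ i, s.ratio q i ≤ (lam : ℝ≥0∞))
    {α : ConstructionTree N X → FiniteMeasure X} (hα : Measurable α)
    (hαq : ∀ᵐ ω ∂treeMeasure 𝒮, α ω ∈ Mq X q) {γ : ℝ≥0}
    (htail : WeakTail (treeMeasure 𝒮) (fun ω => minimalMetric q (α ω) (treeApply α ω)) γ) :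
    ∃ μs : ConstructionTree N X → FiniteMeasure X, Measurable μs ∧
      (∀ᵐ ω ∂treeMeasure 𝒮, μs ω ∈ Mq X q) ∧
      (∀ᵐ ω ∂treeMeasure 𝒮, treeApply μs ω = μs ω) ∧
      (∀ᵐ ω ∂treeMeasure 𝒮,
        Tendsto (fun n => minimalMetric q (treeApply^[n] α ω) (μs ω)) atTop (𝓝 0)) ∧
      ∀ μ₀ : ConstructionTree N X → FiniteMeasure X,
        (∀ᵐ ω ∂treeMeasure 𝒮, (μ₀ ω).mass = 1) → ∀ γ' : ℝ≥0,
        WeakTail (treeMeasure 𝒮) (fun ω => minimalMetric q (α ω) (μ₀ ω)) γ' →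
        ∀ κ : ℝ≥0, lam < κ → κ < 1 → ∃ A : ℝ≥0, ∀ n, WeakTail (treeMeasure 𝒮)
          (fun ω => minimalMetric q (treeApply^[n] μ₀ ω) (μs ω)) (A * κ ^ n) := by
  have hmass : ∀ᵐ ω ∂treeMeasure 𝒮, (α ω).mass = 1 := hαq.mono fun ω h => h.1
  have hmassn := ae_mass_iterate_treeApply hsum hmass
  have hL : ∀ κ : ℝ≥0, lam < κ → κ < 1 → ∃ C : ℝ≥0, ∀ n, WeakTail (treeMeasure 𝒮)
      (fun ω => ∑' k, minimalMetric q (treeApply^[n + k] α ω) (treeApply^[n + k + 1] α ω))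
        (C * κ ^ n) := by
    intro κ h1 h2
    obtain ⟨A, hA⟩ := exists_weakTail_iterate hsum hq hq1 h1 hlam hmass
      (ae_mass_treeApply hsum hmass) htail
    exact WeakTail.tsum_geometric h2 hA
  obtain ⟨κ, hκ1, hκ2⟩ := exists_between hlam1
  obtain ⟨C₀, hC₀⟩ := hL κ hκ1 hκ2
  have hfin : ∀ᵐ ω ∂treeMeasure 𝒮,
      ∑' n, minimalMetric q (treeApply^[n] α ω) (treeApply^[n + 1] α ω) < ∞ := by
    simpa using (hC₀ 0).ae_lt_top (by simp)
  obtain ⟨μs, hμs, hμsm, hle, hlim⟩ := exists_measurable_limit hq hq1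
    (μ := fun n => treeApply^[n] α) (measurable_iterate_treeApply hα) hmassn hfin
  refine ⟨μs, hμs, ?_, ?_, hlim, ?_⟩
  · filter_upwards [hαq, hμsm, hle, hfin] with ω h1 h2 h3 h4
    refine mem_Mq_of_minimalMetric_ne_top hq hq1 h1 h2 (ne_top_of_le_ne_top h4.ne ?_)
    simpa using h3 0
  -- By contraction `𝐒(𝐒ⁿα)` tends to `𝐒μ*`, and as a shifted sequence of iterates it tends to `μ*`;
  -- the limits agree. The subtrees are handled by transferring the almost sure convergence to each
  -- of them.
  · have hstep : ∀ᵐ ω ∂treeMeasure 𝒮, ∀ n,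
        minimalMetric q (treeApply (treeApply^[n] α) ω) (treeApply μs ω) ≤
          ∑ i, (ω []).ratio q i *
            minimalMetric q (treeApply^[n] α (subtree ω i)) (μs (subtree ω i)) :=
      ae_all_iff.2 fun n => ae_minimalMetric_treeApply_le hq hq1 (hmassn n) hμsm
    filter_upwards [hstep, hlim, ae_forall_subtree hlim] with ω h1 h2 h3
    refine eq_of_tendsto_minimalMetric hq hq1 (μ := fun n => treeApply^[n + 1] α ω) ?_
      (h2.comp (tendsto_add_atTop_nat 1))
    simp only [Function.iterate_succ_apply']
    refine tendsto_of_tendsto_of_tendsto_of_le_of_le tendsto_const_nhds ?_ (fun _ => zero_le) h1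
    have h4 := tendsto_finsetSum Finset.univ fun i _ =>
      ENNReal.Tendsto.const_mul (h3 i) (Or.inr ((ω []).ratio_ne_top hq.le i))
    simpa using h4
  · intro μ₀ hμ₀ γ' hγ' κ h1 h2
    obtain ⟨A, hA⟩ := exists_weakTail_iterate hsum hq hq1 h1 hlam hmass hμ₀ hγ'
    obtain ⟨C, hC⟩ := hL κ h1 h2
    -- The comparison goes through `𝐒ⁿα`; the factor 2 is the cost of splitting the threshold in the
    -- sum of two weak tails.
    refine ⟨2 * (A + C), fun n => ((hA n).add (hC n)).mono ?_ (le_of_eq ?_)⟩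
    · filter_upwards [hmassn n, ae_mass_iterate_treeApply hsum hμ₀ n, hμsm, hle] with ω h3 h4 h5 h6
      refine (minimalMetric_triangle hq hq1 h4 h3 h5).trans (add_le_add ?_ (h6 n))
      exact minimalMetric_comm_le hq hq1 _ _
    · push_cast; ring

end FixedPoint

/-! ### Laws of random measures via characteristic functions. -/

section LawDetermination

variable {X : Type*} [MetricSpace X] [MeasurableSpace X] [BorelSpace X] {q : ℝ}

/-- The law of a random finite measure is determined by the characteristic functions of its
integrals against test functions. -/
theorem ext_of_integral_exp (hq : 0 < q) (hq1 : q ≤ 1) {𝒟 𝒟' : Measure (FiniteMeasure X)}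
    [IsProbabilityMeasure 𝒟] [IsProbabilityMeasure 𝒟']
    (h : ∀ f : X → ℝ, IsTestFunction q f →
      ∫ m : FiniteMeasure X, Complex.exp ((∫ x, f x ∂(m : Measure X) : ℝ) * Complex.I) ∂𝒟 =
        ∫ m : FiniteMeasure X, Complex.exp ((∫ x, f x ∂(m : Measure X) : ℝ) * Complex.I) ∂𝒟') :
    𝒟 = 𝒟' := by
  classical
  let T := {f : X → ℝ // IsTestFunction q f}
  let Ψ : FiniteMeasure X → T → ℝ := fun m f => ∫ x, f.1 x ∂(m : Measure X)
  have hΨ : Measurable Ψ := measurable_pi_lambda _ fun f => f.2.measurable_integral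
  have hres : ∀ I : Finset T, (𝒟'.map Ψ).map I.restrict = (𝒟.map Ψ).map I.restrict := by
    intro I
    have hI : Measurable (I.restrict ∘ Ψ) := (Finset.measurable_restrict I).comp hΨ
    rw [Measure.map_map (Finset.measurable_restrict I) hΨ,
      Measure.map_map (Finset.measurable_restrict I) hΨ]
    have h1 : IsProbabilityMeasure (𝒟.map (I.restrict ∘ Ψ)) :=
      Measure.isProbabilityMeasure_map hI.aemeasurable
    have h2 : IsProbabilityMeasure (𝒟'.map (I.restrict ∘ Ψ)) :=
      Measure.isProbabilityMeasure_map hI.aemeasurable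
    refine Measure.ext_of_charFunDual (funext fun L => ?_)
    -- As in the Cramér–Wold device, a linear functional of finitely many integrals is the integral
    -- of one test function, so the hypothesis gives all finite-dimensional characteristic
    -- functions.
    let c : I → ℝ := fun i => L (Pi.single i 1)
    have hL : ∀ m, L ((I.restrict ∘ Ψ) m) =
        ∫ x, ∑ i ∈ Finset.univ, c i * i.1.1 x ∂(m : Measure X) := by
      intro m
      rw [integral_finsetSum _ fun (i : I) _ => (i.1.2.integrable (m : Measure X)).const_mul (c i)]
      conv_lhs => rw [← Finset.univ_sum_single ((I.restrict ∘ Ψ) m), map_sum]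
      refine Finset.sum_congr rfl fun i _ => ?_
      rw [integral_const_mul]
      have : (Pi.single i ((I.restrict ∘ Ψ) m i) : I → ℝ) =
          ((I.restrict ∘ Ψ) m i) • Pi.single i 1 := by
        rw [← Pi.single_smul, smul_eq_mul, mul_one]
      rw [this, map_smul, smul_eq_mul, mul_comm]
      rfl
    have hmeas : ∀ ν : Measure (I → ℝ), AEStronglyMeasurable
        (fun v => Complex.exp ((L v : ℝ) * Complex.I)) ν := fun ν =>
      (Measurable.aestronglyMeasurable (by fun_prop))
    rw [charFunDual_apply, charFunDual_apply, integral_map hI.aemeasurable (hmeas _),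
      integral_map hI.aemeasurable (hmeas _)]
    simp only [hL]
    exact (h _ (IsTestFunction.sum Finset.univ c fun i : I => i.1.2)).symm
  have hmap : 𝒟.map Ψ = 𝒟'.map Ψ := by
    have h1 : IsProbabilityMeasure (𝒟.map Ψ) := Measure.isProbabilityMeasure_map hΨ.aemeasurable
    have h3 : ∀ I : Finset T, IsFiniteMeasure ((𝒟.map Ψ).map I.restrict) := fun I => inferInstance
    exact IsProjectiveLimit.unique (P := fun I => (𝒟.map Ψ).map I.restrict) (fun I => rfl) hres
  -- The integrals against test functions generate the σ-algebra of finite measures, so equality of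
  -- the laws of `Ψ` suffices.
  have hcomap : Measurable[MeasurableSpace.comap Ψ inferInstance] (id : FiniteMeasure X → _) :=
    @measurable_of_measurable_integral X _ _ q _ hq hq1 (FiniteMeasure X)
      (MeasurableSpace.comap Ψ inferInstance) id fun f hf =>
        (measurable_pi_apply (⟨f, hf⟩ : T)).comp (comap_measurable Ψ)
  ext A hA
  obtain ⟨B, hB, hAB⟩ := hcomap hA
  rw [Set.preimage_id] at hAB
  rw [← hAB, ← Measure.map_apply hΨ hB, ← Measure.map_apply hΨ hB, hmap]

end LawDetermination

/-! ### Uniqueness of the invariant law without moment assumptions. -/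

section Uniqueness

variable {N : ℕ} {X : Type*} [MetricSpace X] [SecondCountableTopology X] [MeasurableSpace X]
  [BorelSpace X] {q : ℝ} {𝒮 : Measure (ScalingLaw N X)} [IsProbabilityMeasure 𝒮]

/-- The law of `(∑ p_i S_i μ⁽ⁱ⁾, ∑ p_i S_i ν⁽ⁱ⁾)` where the `(μ⁽ⁱ⁾, ν⁽ⁱ⁾)` are independent with
distribution `Q`, and independent of the scaling law. -/
noncomputable def coupledApply (𝒮 : Measure (ScalingLaw N X))
    (Q : Measure (FiniteMeasure X × FiniteMeasure X)) :
    Measure (FiniteMeasure X × FiniteMeasure X) :=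
  (𝒮.prod (Measure.pi fun _ : Fin N => Q)).map
    fun z => (z.1.combine fun i => (z.2 i).1, z.1.combine fun i => (z.2 i).2)

theorem measurable_combine_comp {α : Type*} [MeasurableSpace α] {g : α → FiniteMeasure X}
    (hg : Measurable g) :
    Measurable fun z : ScalingLaw N X × (Fin N → α) => z.1.combine fun i => g (z.2 i) := by
  have h : Measurable fun z : ScalingLaw N X × (Fin N → α) => (z.1, fun i => g (z.2 i)) := by
    fun_prop
  exact ScalingLaw.measurable_combine.comp h

theorem measurable_coupledApply : Measurable
    fun z : ScalingLaw N X × (Fin N → FiniteMeasure X × FiniteMeasure X) =>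
      (z.1.combine fun i => (z.2 i).1, z.1.combine fun i => (z.2 i).2) :=
  (measurable_combine_comp measurable_fst).prodMk (measurable_combine_comp measurable_snd)

theorem isProbabilityMeasure_coupledApply (Q : Measure (FiniteMeasure X × FiniteMeasure X))
    [IsProbabilityMeasure Q] : IsProbabilityMeasure (coupledApply 𝒮 Q) :=
  Measure.isProbabilityMeasure_map measurable_coupledApply.aemeasurable

theorem map_combine_comp {α : Type*} [MeasurableSpace α] (Q : Measure α) [IsProbabilityMeasure Q]
    {g : α → FiniteMeasure X} (hg : Measurable g) :
    (𝒮.prod (Measure.pi fun _ : Fin N => Q)).map (fun z => z.1.combine fun i => g (z.2 i)) =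
      distApply 𝒮 (Q.map g) := by
  have hP : IsProbabilityMeasure (Q.map g) := Measure.isProbabilityMeasure_map hg.aemeasurable
  have h1 : (𝒮.prod (Measure.pi fun _ : Fin N => Q)).map (Prod.map id fun z i => g (z i)) =
      𝒮.prod (Measure.pi fun _ : Fin N => Q.map g) := by
    rw [← Measure.map_prod_map _ _ measurable_id (by fun_prop), Measure.map_id,
      ← Measure.pi_map_pi fun _ => hg.aemeasurable]
  rw [distApply, ← h1, Measure.map_map ScalingLaw.measurable_combine (by fun_prop)]
  rfl

theorem map_fst_coupledApply (Q : Measure (FiniteMeasure X × FiniteMeasure X))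
    [IsProbabilityMeasure Q] :
    (coupledApply 𝒮 Q).map Prod.fst = distApply 𝒮 (Q.map Prod.fst) := by
  rw [coupledApply, Measure.map_map measurable_fst measurable_coupledApply,
    ← map_combine_comp Q measurable_fst]
  rfl

theorem map_snd_coupledApply (Q : Measure (FiniteMeasure X × FiniteMeasure X))
    [IsProbabilityMeasure Q] :
    (coupledApply 𝒮 Q).map Prod.snd = distApply 𝒮 (Q.map Prod.snd) := by
  rw [coupledApply, Measure.map_map measurable_snd measurable_coupledApply,
    ← map_combine_comp Q measurable_snd]
  rfl

theorem edist_sum_mul_le {ι : Type*} (s : Finset ι) (p : ι → ℝ≥0) (a b : ι → ℝ) :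
    edist (∑ i ∈ s, (p i : ℝ) * a i) (∑ i ∈ s, (p i : ℝ) * b i) ≤
      ∑ i ∈ s, p i * edist (a i) (b i) := by
  rw [edist_eq_enorm_sub, ← Finset.sum_sub_distrib]
  refine (enorm_sum_le _ _).trans (Finset.sum_le_sum fun i _ => ?_)
  rw [← mul_sub, enorm_mul, edist_eq_enorm_sub]
  gcongr
  rw [Real.enorm_eq_ofReal (p i).coe_nonneg, ENNReal.ofReal_coe_nnreal]

omit [MetricSpace X] [SecondCountableTopology X] [BorelSpace X] in
theorem measurable_edist_integral {f : X → ℝ} (hf : Measurable f) {C : ℝ}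
    (hC : ∀ x, |f x| ≤ C) : Measurable fun z : FiniteMeasure X × FiniteMeasure X =>
      edist (∫ x, f x ∂(z.1 : Measure X)) (∫ x, f x ∂(z.2 : Measure X)) :=
  ((measurable_integral_finiteMeasure hf hC).comp measurable_fst).edist
    ((measurable_integral_finiteMeasure hf hC).comp measurable_snd)

-- Averaging keeps the truncation level `B` because the weights sum to one, and contracts the other
-- argument of the minimum by `lam`.
omit [SecondCountableTopology X] [MeasurableSpace X] [BorelSpace X] in
theorem sum_weight_mul_min_le (s : ScalingLaw N X) (hs : ∑ i, s.weight i = 1) {lam : ℝ≥0∞}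
    (hlam : ∑ i, s.ratio q i ≤ lam) (B v : ℝ≥0∞) :
    ∑ i, (s.weight i : ℝ≥0∞) * min B (v * lipConst (s.map i) ^ q) ≤ min B (v * lam) := by
  refine le_min ?_ ?_
  · calc ∑ i, (s.weight i : ℝ≥0∞) * min B (v * lipConst (s.map i) ^ q)
        ≤ ∑ i, (s.weight i : ℝ≥0∞) * B := by gcongr; exact min_le_left _ _
      _ = B := by
        rw [← Finset.sum_mul, ← ENNReal.ofNNReal_finsetSum, hs, ENNReal.coe_one, one_mul]
  · calc ∑ i, (s.weight i : ℝ≥0∞) * min B (v * lipConst (s.map i) ^ q)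
        ≤ ∑ i, (s.weight i : ℝ≥0∞) * (v * lipConst (s.map i) ^ q) := by
          gcongr; exact min_le_right _ _
      _ = v * ∑ i, s.ratio q i := by
        rw [Finset.mul_sum]
        exact Finset.sum_congr rfl fun i _ => by rw [ScalingLaw.ratio]; ring
      _ ≤ v * lam := by gcongr

/-- `Q` couples two random measures so that integrals of functions bounded by `C` with modulus
`u d ^ q` differ in mean by at most `∫ min B (κ u d(x,a) ^ q) dζ(x)`. -/
def CouplingBound (q C : ℝ) (B : ℝ≥0∞) (a : X) (ζ : Measure X) (κ : ℝ≥0∞)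
    (Q : Measure (FiniteMeasure X × FiniteMeasure X)) : Prop :=
  ∀ (f : X → ℝ) (u : ℝ≥0∞), Measurable f → (∀ x, |f x| ≤ C) →
    (∀ x y, edist (f x) (f y) ≤ u * edist x y ^ q) →
    ∫⁻ z, edist (∫ x, f x ∂(z.1 : Measure X)) (∫ x, f x ∂(z.2 : Measure X)) ∂Q ≤
      ∫⁻ x, min B (κ * u * edist x a ^ q) ∂ζ

/-- On branch `i` the integrand becomes `f ∘ S_i`, with the same bound `C` and modulus `u r_i ^ q`.
This is why the bound is required for all `u` at once; the reference measure `ζ` and the point `a`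
never change. -/
theorem CouplingBound.coupledApply (hsum : ∀ᵐ s ∂𝒮, ∑ i, s.weight i = 1) (hq : 0 < q)
    {lam : ℝ≥0∞} (hlam : ∀ᵐ s ∂𝒮, ∑ i, s.ratio q i ≤ lam) {C : ℝ} {B κ : ℝ≥0∞} {a : X}
    {ζ : Measure X} {Q : Measure (FiniteMeasure X × FiniteMeasure X)} [IsProbabilityMeasure Q]
    (h : CouplingBound q C B a ζ κ Q) :
    CouplingBound q C B a ζ (κ * lam) (coupledApply 𝒮 Q) := by
  intro f u hf hC hu
  have hm := measurable_edist_integral hf hC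
  rw [RandomFractal.coupledApply, lintegral_map hm measurable_coupledApply]
  refine (lintegral_prod _ (hm.comp measurable_coupledApply).aemeasurable).trans_le ?_
  have hmin : ∀ v : ℝ≥0∞, Measurable fun x : X => min B (v * edist x a ^ q) := fun v => by
    fun_prop
  have hs : ∀ᵐ s ∂𝒮, ∫⁻ z : Fin N → FiniteMeasure X × FiniteMeasure X,
      edist (∫ x, f x ∂((s.combine fun i => (z i).1 : FiniteMeasure X) : Measure X))
        (∫ x, f x ∂((s.combine fun i => (z i).2 : FiniteMeasure X) : Measure X))
          ∂(Measure.pi fun _ => Q) ≤ ∫⁻ x, min B (κ * lam * u * edist x a ^ q) ∂ζ := by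
    filter_upwards [hsum, hlam] with s hs1 hs2
    have hfi : ∀ i, Measurable fun x => f (s.map i x) := fun i =>
      hf.comp (s.continuous_map i).measurable
    have hmi := fun i => measurable_edist_integral (hfi i) fun x => hC _
    have hev := fun i => measurePreserving_eval (fun _ : Fin N => Q) i
    calc _ ≤ ∫⁻ z : Fin N → FiniteMeasure X × FiniteMeasure X,
          ∑ i, s.weight i * edist (∫ x, f (s.map i x) ∂((z i).1 : Measure X))
            (∫ x, f (s.map i x) ∂((z i).2 : Measure X)) ∂(Measure.pi fun _ => Q) := by
          refine lintegral_mono fun z => ?_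
          rw [s.integral_combine _ hf hC, s.integral_combine _ hf hC]
          exact edist_sum_mul_le _ _ _ _
      _ = ∑ i, s.weight i * ∫⁻ z, edist (∫ x, f (s.map i x) ∂(z.1 : Measure X))
            (∫ x, f (s.map i x) ∂(z.2 : Measure X)) ∂Q := by
          have hmz : ∀ i, Measurable fun z : Fin N → FiniteMeasure X × FiniteMeasure X =>
              edist (∫ x, f (s.map i x) ∂((z i).1 : Measure X))
                (∫ x, f (s.map i x) ∂((z i).2 : Measure X)) := fun i =>
            (hmi i).comp (measurable_pi_apply i)
          rw [lintegral_finsetSum _ fun i _ => (hmz i).const_mul (s.weight i : ℝ≥0∞)]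
          refine Finset.sum_congr rfl fun i _ => ?_
          rw [lintegral_const_mul (s.weight i : ℝ≥0∞) (hmz i)]
          congr 1
          exact (hev i).lintegral_comp (hmi i)
      _ ≤ ∑ i, s.weight i *
            ∫⁻ x, min B (κ * (u * lipConst (s.map i) ^ q) * edist x a ^ q) ∂ζ := by
          gcongr with i _
          refine h _ _ (hfi i) (fun x => hC _) fun x y => (hu _ _).trans ?_
          rw [mul_assoc, ← ENNReal.mul_rpow_of_nonneg _ _ hq.le]
          gcongr
          exact edist_le_lipConst_mul (s.map i) _ _
      _ = ∫⁻ x, ∑ i, (s.weight i : ℝ≥0∞) *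
            min B (κ * u * edist x a ^ q * lipConst (s.map i) ^ q) ∂ζ := by
          rw [lintegral_finsetSum _ fun i _ => by fun_prop]
          refine Finset.sum_congr rfl fun i _ => ?_
          rw [lintegral_const_mul _ (by fun_prop)]
          congr 1
          refine lintegral_congr fun x => ?_
          congr 1
          ring
      _ ≤ ∫⁻ x, min B (κ * lam * u * edist x a ^ q) ∂ζ := by
          refine lintegral_mono fun x => ?_
          refine (sum_weight_mul_min_le s hs1 hs2 B _).trans_eq ?_
          congr 1
          ring
  calc _ ≤ ∫⁻ _, ∫⁻ x, min B (κ * lam * u * edist x a ^ q) ∂ζ ∂𝒮 := lintegral_mono_ae hs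
    _ = _ := by rw [lintegral_const, measure_univ, mul_one]

omit [SecondCountableTopology X] [BorelSpace X] in
theorem edist_integral_apply_le {f : X → ℝ} (hf : Measurable f) {C : ℝ} (hC : ∀ x, |f x| ≤ C)
    {u : ℝ≥0∞} (hu : ∀ x y, edist (f x) (f y) ≤ u * edist x y ^ q) (a : X) {m : FiniteMeasure X}
    (hm : m.mass = 1) : edist (∫ x, f x ∂(m : Measure X)) (f a) ≤
      ∫⁻ x, min (ENNReal.ofReal (2 * C)) (u * edist x a ^ q) ∂(m : Measure X) := by
  have := isProbabilityMeasure_of_mass hm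
  have h1 : f a = ∫ _, f a ∂(m : Measure X) := by simp
  rw [h1]
  refine (edist_integral_le_lintegral (Integrable.of_bound hf.aestronglyMeasurable C
    (ae_of_all _ hC)) (integrable_const _)).trans (lintegral_mono fun x => le_min ?_ (hu x a))
  rw [edist_dist, Real.dist_eq]
  refine ENNReal.ofReal_le_ofReal ?_
  have h2 := abs_le.1 (hC x)
  have h3 := abs_le.1 (hC a)
  exact abs_le.2 ⟨by linarith, by linarith⟩

/-- The mean measure `A ↦ ∫ m(A) d𝒟(m)`. -/
noncomputable def meanMeasure (𝒟 : Measure (FiniteMeasure X)) : Measure X :=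
  𝒟.bind fun m => (m : Measure X)

omit [MetricSpace X] [SecondCountableTopology X] [BorelSpace X] in
theorem lintegral_meanMeasure (𝒟 : Measure (FiniteMeasure X)) {g : X → ℝ≥0∞} (hg : Measurable g) :
    ∫⁻ x, g x ∂meanMeasure 𝒟 = ∫⁻ m, ∫⁻ x, g x ∂(m : Measure X) ∂𝒟 :=
  Measure.lintegral_bind measurable_subtype_coe.aemeasurable hg.aemeasurable

omit [MetricSpace X] [SecondCountableTopology X] [BorelSpace X] in
theorem isFiniteMeasure_meanMeasure {𝒟 : Measure (FiniteMeasure X)} [IsProbabilityMeasure 𝒟]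
    (h : ∀ᵐ m ∂𝒟, m.mass = 1) : IsFiniteMeasure (meanMeasure 𝒟) := by
  refine ⟨?_⟩
  rw [← lintegral_one, lintegral_meanMeasure 𝒟 measurable_const]
  have h1 : ∀ᵐ m : FiniteMeasure X ∂𝒟, ∫⁻ _, 1 ∂(m : Measure X) = 1 := by
    filter_upwards [h] with m hm
    rw [lintegral_one, ← FiniteMeasure.ennreal_mass, hm, ENNReal.coe_one]
  rw [lintegral_congr_ae h1]
  simp

-- Both integrals are compared with `f a`; averaging the two errors yields the sum of the mean
-- measures.
omit [SecondCountableTopology X] in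
theorem couplingBound_prod (C : ℝ) (a : X) {𝒟 𝒟' : Measure (FiniteMeasure X)}
    [IsProbabilityMeasure 𝒟] [IsProbabilityMeasure 𝒟'] (h : ∀ᵐ m ∂𝒟, m.mass = 1)
    (h' : ∀ᵐ m ∂𝒟', m.mass = 1) :
    CouplingBound q C (ENNReal.ofReal (2 * C)) a (meanMeasure 𝒟 + meanMeasure 𝒟') 1
      (𝒟.prod 𝒟') := by
  intro f u hf hC hu
  have hmin : Measurable fun x : X => min (ENNReal.ofReal (2 * C)) (1 * u * edist x a ^ q) := by
    fun_prop
  have hmI := measurable_integral_finiteMeasure hf hC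
  rw [lintegral_add_measure, lintegral_meanMeasure _ hmin, lintegral_meanMeasure _ hmin]
  calc _ ≤ ∫⁻ z : FiniteMeasure X × FiniteMeasure X,
        edist (∫ x, f x ∂(z.1 : Measure X)) (f a) + edist (∫ x, f x ∂(z.2 : Measure X)) (f a)
          ∂(𝒟.prod 𝒟') := lintegral_mono fun z => edist_triangle_right _ _ _
    _ = (∫⁻ m, edist (∫ x, f x ∂(m : Measure X)) (f a) ∂𝒟) +
          ∫⁻ m, edist (∫ x, f x ∂(m : Measure X)) (f a) ∂𝒟' := by
        have h1 : Measurable fun m : FiniteMeasure X => edist (∫ x, f x ∂(m : Measure X)) (f a) :=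
          hmI.edist measurable_const
        have h2 : Measurable fun z : FiniteMeasure X × FiniteMeasure X =>
            edist (∫ x, f x ∂(z.1 : Measure X)) (f a) := h1.comp measurable_fst
        rw [lintegral_add_left h2]
        congr 1
        · exact (measurePreserving_fst (μ := 𝒟) (ν := 𝒟')).lintegral_comp h1
        · exact (measurePreserving_snd (μ := 𝒟) (ν := 𝒟')).lintegral_comp h1
    _ ≤ _ := by
        refine add_le_add (lintegral_mono_ae ?_) (lintegral_mono_ae ?_)
        · filter_upwards [h] with m hm
          simpa only [one_mul] using edist_integral_apply_le hf hC hu a hm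
        · filter_upwards [h'] with m hm
          simpa only [one_mul] using edist_integral_apply_le hf hC hu a hm

-- The constant `B` dominates and `ζ` is finite, so no moment of `ζ` is needed; this removes moment
-- conditions from uniqueness.
omit [SecondCountableTopology X] in
theorem tendsto_lintegral_min (hq : 0 ≤ q) {lam u B : ℝ≥0∞} (hlam : lam < 1) (hu : u ≠ ∞)
    (hB : B ≠ ∞) (a : X) (ζ : Measure X) [IsFiniteMeasure ζ] :
    Tendsto (fun n : ℕ => ∫⁻ x, min B (lam ^ n * u * edist x a ^ q) ∂ζ) atTop (𝓝 0) := by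
  have h := tendsto_lintegral_of_dominated_convergence (μ := ζ)
    (F := fun (n : ℕ) x => min B (lam ^ n * u * edist x a ^ q)) (f := fun _ => 0) (fun _ => B)
    (fun n => by fun_prop) (fun n => ae_of_all _ fun x => min_le_left _ _)
    (by rw [lintegral_const]; exact ENNReal.mul_ne_top hB (measure_ne_top _ _))
    (ae_of_all _ fun x => ?_)
  · simpa using h
  · have h1 : Tendsto (fun n : ℕ => lam ^ n * (u * edist x a ^ q)) atTop
        (𝓝 (0 * (u * edist x a ^ q))) :=
      ENNReal.Tendsto.mul_const (ENNReal.tendsto_pow_atTop_nhds_zero_of_lt_one hlam)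
        (Or.inr (ENNReal.mul_ne_top hu (ENNReal.rpow_ne_top_of_nonneg hq (edist_ne_top x a))))
    rw [zero_mul] at h1
    refine tendsto_of_tendsto_of_tendsto_of_le_of_le tendsto_const_nhds h1 (fun _ => zero_le)
      fun n => ?_
    simp only
    rw [← mul_assoc]
    exact min_le_right _ _

theorem edist_exp_mul_I_le (a b : ℝ) :
    edist (Complex.exp (a * Complex.I)) (Complex.exp (b * Complex.I)) ≤ edist a b := by
  have h : Complex.exp (a * Complex.I) - Complex.exp (b * Complex.I) =
      Complex.exp (b * Complex.I) * (Complex.exp (Complex.I * (a - b : ℝ)) - 1) := by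
    rw [mul_sub, ← Complex.exp_add, mul_one]
    congr 2
    push_cast
    ring
  rw [edist_eq_enorm_sub, h, enorm_mul, edist_eq_enorm_sub]
  have h1 : ‖Complex.exp (b * Complex.I)‖ₑ = 1 := by
    rw [mul_comm]; exact Complex.enorm_exp_I_mul_ofReal b
  rw [h1, one_mul]
  exact Real.enorm_exp_I_mul_ofReal_sub_one_le

omit [SecondCountableTopology X] [BorelSpace X] in
theorem edist_integral_exp_le {f : X → ℝ} (hf : IsTestFunction q f)
    (Q : Measure (FiniteMeasure X × FiniteMeasure X)) [IsProbabilityMeasure Q] :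
    edist (∫ m : FiniteMeasure X, Complex.exp ((∫ x, f x ∂(m : Measure X) : ℝ) * Complex.I)
        ∂(Q.map Prod.fst))
      (∫ m : FiniteMeasure X, Complex.exp ((∫ x, f x ∂(m : Measure X) : ℝ) * Complex.I)
        ∂(Q.map Prod.snd)) ≤
      ∫⁻ z, edist (∫ x, f x ∂(z.1 : Measure X)) (∫ x, f x ∂(z.2 : Measure X)) ∂Q := by
  have hE : Measurable fun m : FiniteMeasure X =>
      Complex.exp ((∫ x, f x ∂(m : Measure X) : ℝ) * Complex.I) := by
    have := hf.measurable_integral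
    fun_prop
  have hn : ∀ m : FiniteMeasure X,
      ‖Complex.exp ((∫ x, f x ∂(m : Measure X) : ℝ) * Complex.I)‖ ≤ 1 := fun m => by
    rw [Complex.norm_exp_ofReal_mul_I]
  rw [integral_map measurable_fst.aemeasurable hE.aestronglyMeasurable,
    integral_map measurable_snd.aemeasurable hE.aestronglyMeasurable, edist_eq_enorm_sub,
    ← integral_sub]
  · refine (enorm_integral_le_lintegral_enorm _).trans (lintegral_mono fun z => ?_)
    simp only
    rw [← edist_eq_enorm_sub]
    exact edist_exp_mul_I_le _ _
  · exact Integrable.of_bound (hE.comp measurable_fst).aestronglyMeasurable 1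
      (ae_of_all _ fun z => hn _)
  · exact Integrable.of_bound (hE.comp measurable_snd).aestronglyMeasurable 1
      (ae_of_all _ fun z => hn _)

/-- A unit mass distribution invariant under `𝒮` is the law of the limit of the iterates. -/
theorem eq_map_of_distApply_eq (hsum : ∀ᵐ s ∂𝒮, ∑ i, s.weight i = 1) (hq : 0 < q) (hq1 : q ≤ 1)
    {lam : ℝ≥0∞} (hlam1 : lam < 1) (hlam : ∀ᵐ s ∂𝒮, ∑ i, s.ratio q i ≤ lam)
    {α μs : ConstructionTree N X → FiniteMeasure X} (hα : Measurable α) (hμs : Measurable μs)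
    (hmass : ∀ᵐ ω ∂treeMeasure 𝒮, (α ω).mass = 1)
    (hlim : ∀ᵐ ω ∂treeMeasure 𝒮,
      Tendsto (fun n => minimalMetric q (treeApply^[n] α ω) (μs ω)) atTop (𝓝 0))
    {𝒟 : Measure (FiniteMeasure X)} [IsProbabilityMeasure 𝒟] (h𝒟 : ∀ᵐ m ∂𝒟, m.mass = 1)
    (hfix : distApply 𝒮 𝒟 = 𝒟) : 𝒟 = (treeMeasure 𝒮).map μs := by
  have hα' : IsProbabilityMeasure ((treeMeasure 𝒮).map α) :=
    Measure.isProbabilityMeasure_map hα.aemeasurable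
  have hμs' : IsProbabilityMeasure ((treeMeasure 𝒮).map μs) :=
    Measure.isProbabilityMeasure_map hμs.aemeasurable
  have hαm : ∀ᵐ m ∂(treeMeasure 𝒮).map α, m.mass = 1 := by
    have hms : MeasurableSet {m : FiniteMeasure X | m.mass = 1} := by
      have h1 : Measurable fun m : FiniteMeasure X => (m : Measure X) Set.univ :=
        (Measure.measurable_coe MeasurableSet.univ).comp measurable_subtype_coe
      have h2 : {m : FiniteMeasure X | m.mass = 1} =
          (fun m : FiniteMeasure X => (m : Measure X) Set.univ) ⁻¹' {1} := by
        ext m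
        rw [Set.mem_preimage, Set.mem_singleton_iff, ← FiniteMeasure.ennreal_mass,
          ENNReal.coe_eq_one]
        rfl
      rw [h2]
      exact h1 (measurableSet_singleton 1)
    exact (ae_map_iff hα.aemeasurable hms).2 hmass
  obtain ⟨m₀, hm₀⟩ := h𝒟.exists
  obtain ⟨a⟩ := nonempty_of_mass hm₀
  -- The first marginal stays `𝒟` by invariance, the second is the law of the `n`-th iterate of `α`.
  -- Both are driven by the same scaling laws, so they approach each other.
  let Q : ℕ → Measure (FiniteMeasure X × FiniteMeasure X) := fun n =>
    (coupledApply 𝒮)^[n] (𝒟.prod ((treeMeasure 𝒮).map α))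
  have hQs : ∀ n, Q (n + 1) = coupledApply 𝒮 (Q n) := fun n => Function.iterate_succ_apply' _ _ _
  have hQ : ∀ n, IsProbabilityMeasure (Q n) := fun n => by
    induction n with
    | zero => exact inferInstanceAs (IsProbabilityMeasure (𝒟.prod ((treeMeasure 𝒮).map α)))
    | succ n ih => rw [hQs]; exact isProbabilityMeasure_coupledApply _
  have hQ1 : ∀ n, (Q n).map Prod.fst = 𝒟 := fun n => by
    induction n with
    | zero => exact (measurePreserving_fst (μ := 𝒟)).map_eq
    | succ n ih => rw [hQs, map_fst_coupledApply, ih, hfix]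
  have hQ2 : ∀ n, (Q n).map Prod.snd = (treeMeasure 𝒮).map (treeApply^[n] α) := fun n => by
    induction n with
    | zero => exact (measurePreserving_snd (μ := 𝒟)).map_eq
    | succ n ih =>
      rw [hQs, map_snd_coupledApply, ih, Function.iterate_succ_apply',
        map_treeApply 𝒮 (measurable_iterate_treeApply hα n)]
  have hf1 := isFiniteMeasure_meanMeasure h𝒟
  have hf2 := isFiniteMeasure_meanMeasure hαm
  refine ext_of_integral_exp hq hq1 fun f hf => ?_
  obtain ⟨hfm, ⟨C, hC⟩, u, hu⟩ := id hf
  have hbound : ∀ n, CouplingBound q C (ENNReal.ofReal (2 * C)) a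
      (meanMeasure 𝒟 + meanMeasure ((treeMeasure 𝒮).map α)) (lam ^ n) (Q n) := fun n => by
    induction n with
    | zero => rw [pow_zero]; exact couplingBound_prod C a h𝒟 hαm
    | succ n ih => rw [hQs, pow_succ]; exact ih.coupledApply hsum hq hlam
  have hE : Measurable fun m : FiniteMeasure X =>
      Complex.exp ((∫ x, f x ∂(m : Measure X) : ℝ) * Complex.I) := by
    have := hf.measurable_integral
    fun_prop
  have ht1 : Tendsto (fun n => ∫ m : FiniteMeasure X,
      Complex.exp ((∫ x, f x ∂(m : Measure X) : ℝ) * Complex.I)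
        ∂(treeMeasure 𝒮).map (treeApply^[n] α)) atTop (𝓝 (∫ m : FiniteMeasure X,
          Complex.exp ((∫ x, f x ∂(m : Measure X) : ℝ) * Complex.I) ∂𝒟)) := by
    rw [tendsto_iff_edist_tendsto_0]
    refine tendsto_of_tendsto_of_tendsto_of_le_of_le tendsto_const_nhds
      (tendsto_lintegral_min hq.le hlam1 (ENNReal.coe_ne_top (r := u))
        (ENNReal.ofReal_ne_top (r := 2 * C)) a
        (meanMeasure 𝒟 + meanMeasure ((treeMeasure 𝒮).map α))) (fun _ => zero_le) fun n => ?_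
    have h1 := edist_integral_exp_le hf (Q n)
    rw [hQ1, hQ2, edist_comm] at h1
    exact h1.trans (hbound n f u hfm hC hu)
  have ht2 : Tendsto (fun n => ∫ m : FiniteMeasure X,
      Complex.exp ((∫ x, f x ∂(m : Measure X) : ℝ) * Complex.I)
        ∂(treeMeasure 𝒮).map (treeApply^[n] α)) atTop (𝓝 (∫ m : FiniteMeasure X,
          Complex.exp ((∫ x, f x ∂(m : Measure X) : ℝ) * Complex.I)
            ∂(treeMeasure 𝒮).map μs)) := by
    rw [integral_map hμs.aemeasurable hE.aestronglyMeasurable]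
    have hmn := fun n => measurable_iterate_treeApply hα n
    simp only [integral_map (hmn _).aemeasurable hE.aestronglyMeasurable]
    refine tendsto_integral_of_dominated_convergence (fun _ => 1)
      (fun n => (hE.comp (hmn n)).aestronglyMeasurable) (integrable_const _)
      (fun n => ae_of_all _ fun ω => ?_) ?_
    · rw [Complex.norm_exp_ofReal_mul_I]
    · filter_upwards [hlim] with ω hω
      have h1 := hf.tendsto_integral hq hq1 hω
      have h2 : Continuous fun r : ℝ => Complex.exp (r * Complex.I) := by fun_prop
      exact (h2.tendsto _).comp h1
  exact tendsto_nhds_unique ht1 ht2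

end Uniqueness

/-! ### Reduction to exponents at most one. -/

section Reduction

variable {X : Type*} [MetricSpace X] [MeasurableSpace X] {q : ℝ}

/-- For `q ≥ 1` the cost of a coupling is the `L^q` norm of the distance under a probability
measure, which dominates the `L¹` norm. -/
theorem minimalMetric_min_one_le [SecondCountableTopology X] [BorelSpace X] (hq : 0 < q)
    {μ ν : FiniteMeasure X} (hμ : μ.mass = 1) :
    minimalMetric (min q 1) μ ν ≤ minimalMetric q μ ν := by
  rcases le_total q 1 with h | h
  · rw [min_eq_left h]
  rw [min_eq_right h]
  refine le_iInf₂ fun π hπ => ?_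
  have := isProbabilityMeasure_of_mass hμ
  have hP : IsProbabilityMeasure π := IsCoupling.isProbabilityMeasure (ν := (ν : Measure X)) hπ
  refine (minimalMetric_le_lintegral one_pos le_rfl hπ).trans ?_
  have h1 : min (1 / q) 1 = 1 / q := min_eq_left (by rw [div_le_one hq]; exact h)
  have h2 := eLpNorm'_le_eLpNorm'_of_exponent_le one_pos h π
    (f := fun z : X × X => dist z.1 z.2) measurable_dist.aestronglyMeasurable
  have h3 : ∀ z : X × X, ‖dist z.1 z.2‖ₑ = edist z.1 z.2 := fun z => by
    rw [Real.enorm_eq_ofReal dist_nonneg, edist_dist]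
  simp only [eLpNorm', h3, div_one, ENNReal.rpow_one] at h2
  simpa only [h1, ENNReal.rpow_one] using h2

theorem Mq_subset_min_one {μ : FiniteMeasure X} (h : μ ∈ Mq X q) : μ ∈ Mq X (min q 1) := by
  rcases le_total q 1 with h1 | h1
  · rwa [min_eq_left h1]
  rw [min_eq_right h1]
  obtain ⟨hm, a, ha⟩ := h
  have := isProbabilityMeasure_of_mass hm
  refine ⟨hm, a, ?_⟩
  calc ∫⁻ x, edist x a ^ (1 : ℝ) ∂(μ : Measure X)
      ≤ ∫⁻ x, (1 + edist x a ^ q) ∂(μ : Measure X) := by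
        refine lintegral_mono fun x => ?_
        rcases le_total (edist x a) 1 with h2 | h2
        · rw [ENNReal.rpow_one]; exact h2.trans le_self_add
        · exact (ENNReal.rpow_le_rpow_of_exponent_le h2 h1).trans le_add_self
    _ = 1 + ∫⁻ x, edist x a ^ q ∂(μ : Measure X) := by
        rw [lintegral_add_left measurable_const]; simp
    _ < ∞ := ENNReal.add_lt_top.2 ⟨ENNReal.one_lt_top, ha⟩

-- For `q ≥ 1` this is the power mean inequality for the probability weights `p_i`; for `q ≤ 1` both
-- sides coincide.
omit [MeasurableSpace X] in
theorem sum_ratio_min_one_le {N : ℕ} (hq : 0 < q) {s : ScalingLaw N X}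
    (hs : ∑ i, s.weight i = 1) :
    ∑ i, s.ratio (min q 1) i ≤ (∑ i, s.ratio q i) ^ min (1 / q) 1 := by
  rcases le_total q 1 with h | h
  · rw [min_eq_left h, min_eq_right (by rwa [le_div_iff₀ hq, one_mul]), ENNReal.rpow_one]
  rw [min_eq_right h, min_eq_left (by rwa [div_le_one hq]), one_div, ENNReal.le_rpow_inv_iff hq]
  simp only [ScalingLaw.ratio, ENNReal.rpow_one]
  refine ENNReal.rpow_arith_mean_le_arith_mean_rpow _ _ _ ?_ h
  rw [← ENNReal.ofNNReal_finsetSum, hs, ENNReal.coe_one]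

theorem ae_sum_ratio_min_one_le {N : ℕ} (hq : 0 < q) {𝒮 : Measure (ScalingLaw N X)}
    (hsum : ∀ᵐ s ∂𝒮, ∑ i, s.weight i = 1) :
    ∀ᵐ s ∂𝒮, ∑ i, s.ratio (min q 1) i ≤ lamSup q 𝒮 ^ min (1 / q) 1 := by
  filter_upwards [hsum, ENNReal.ae_le_essSup
    (fun s : ScalingLaw N X => ∑ i, (s.weight i : ℝ≥0∞) * lipConst (s.map i) ^ q)] with s h1 h2
  exact (sum_ratio_min_one_le hq h1).trans (ENNReal.rpow_le_rpow h2 (by positivity))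

end Reduction

end RandomFractal

open RandomFractal
theorem theorem2p2 {X : Type*} [MetricSpace X] [CompleteSpace X] [SecondCountableTopology X]
    [MeasurableSpace X] [BorelSpace X] {N : ℕ}
    (𝒮 : Measure (ScalingLaw N X)) [IsProbabilityMeasure 𝒮]
    (hsum : ∀ᵐ s ∂𝒮, ∑ i, s.weight i = 1)
    (q : ℝ) (hq : 0 < q) (hlam : lamSup q 𝒮 < 1)
    (α : ConstructionTree N X → FiniteMeasure X) (hα : Measurable α)
    (hαq : ∀ᵐ ω ∂treeMeasure 𝒮, α ω ∈ Mq X q)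
    (htail : HasWeakTail (treeMeasure 𝒮)
      (fun ω => minimalMetric q (α ω) (treeApply α ω))) :
    ∃ μs : ConstructionTree N X → FiniteMeasure X,
      Measurable μs ∧
      (∀ᵐ ω ∂treeMeasure 𝒮, μs ω ∈ Mq X (min q 1)) ∧
      -- `𝐒 μ* = μ*` almost surely
      (∀ᵐ ω ∂treeMeasure 𝒮, treeApply μs ω = μs ω) ∧
      -- exponentially fast convergence of the iterates, in probability and almost surely
      (∀ μ₀ : ConstructionTree N X → FiniteMeasure X, Measurable μ₀ →
        (∀ᵐ ω ∂treeMeasure 𝒮, μ₀ ω ∈ Mq X q) →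
        HasWeakTail (treeMeasure 𝒮)
          (fun ω => minimalMetric q (α ω) (μ₀ ω)) →
        ∀ ρ : ℝ≥0, lamSup q 𝒮 ^ min (1 / q) 1 < (ρ : ℝ≥0∞) → ρ < 1 →
          (∃ C : ℝ, ∀ n : ℕ, ∀ t : ℝ, 0 < t →
            treeMeasure 𝒮 {ω | ENNReal.ofReal t ≤
              minimalMetric (min q 1) (treeApply^[n] μ₀ ω) (μs ω)} ≤
                ENNReal.ofReal (C * (ρ : ℝ) ^ n / t)) ∧
          (∀ᵐ ω ∂treeMeasure 𝒮, ∃ C : ℝ≥0, ∀ n : ℕ,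
            minimalMetric (min q 1) (treeApply^[n] μ₀ ω) (μs ω) ≤
              (C : ℝ≥0∞) * (ρ : ℝ≥0∞) ^ n)) ∧
      -- the distribution of `μ*` is the unique distribution of unit mass random measures
      -- that satisfies the scaling law
      (∀ 𝒟 : Measure (FiniteMeasure X), IsProbabilityMeasure 𝒟 → (∀ᵐ m ∂𝒟, m.mass = 1) →
        (distApply 𝒮 𝒟 = 𝒟 ↔
          𝒟 = (treeMeasure 𝒮).map μs)) := by
  have hq' : 0 < min q 1 := lt_min hq one_pos
  have hq1' : min q 1 ≤ 1 := min_le_right _ _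
  have hratio := ae_sum_ratio_min_one_le hq hsum
  have hlt : lamSup q 𝒮 ^ min (1 / q) 1 < 1 :=
    ENNReal.rpow_lt_one hlam (lt_min (by positivity) one_pos)
  generalize lamSup q 𝒮 ^ min (1 / q) 1 = lam at hratio hlt ⊢
  lift lam to ℝ≥0 using hlt.ne_top
  have hmass : ∀ᵐ ω ∂treeMeasure 𝒮, (α ω).mass = 1 := hαq.mono fun ω h => h.1
  have hαq' : ∀ᵐ ω ∂treeMeasure 𝒮, α ω ∈ Mq X (min q 1) := hαq.mono fun ω h => Mq_subset_min_one h
  obtain ⟨γ, hγ⟩ := htail.exists_weakTail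
  have hγ' : WeakTail (treeMeasure 𝒮)
      (fun ω => minimalMetric (min q 1) (α ω) (treeApply α ω)) γ :=
    hγ.mono (hmass.mono fun ω h => minimalMetric_min_one_le hq h) le_rfl
  obtain ⟨μs, hμs, hMq, hfix, hlim, hconv⟩ := exists_fixedPoint hsum hq' hq1'
    (by exact_mod_cast hlt) hratio hα hαq' hγ'
  refine ⟨μs, hμs, hMq, hfix, ?_, ?_⟩
  · intro μ₀ _ hμ₀q h₀ ρ hρ hρ1
    -- The gap below `κ` absorbs the factor linear in `n`; the gap between `κ` and `ρ` makes the
    -- rescaled distances summable, which yields the almost sure bound.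
    obtain ⟨κ, hκ1, hκ2⟩ := exists_between (ENNReal.coe_lt_coe.1 hρ)
    obtain ⟨γ₀, hγ₀⟩ := h₀.exists_weakTail
    obtain ⟨A, hA⟩ := hconv μ₀ (hμ₀q.mono fun ω h => h.1) γ₀
      (hγ₀.mono (hmass.mono fun ω h => minimalMetric_min_one_le hq h) le_rfl) κ hκ1
      (hκ2.trans hρ1)
    refine ⟨⟨A, fun n t ht => (hA n).measure_le ?_ ht⟩, WeakTail.ae_le_geometric hκ2 hA⟩
    calc (A : ℝ≥0∞) * (κ : ℝ≥0∞) ^ n ≤ A * (ρ : ℝ≥0∞) ^ n := by gcongr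
      _ = ENNReal.ofReal (A * (ρ : ℝ) ^ n) := by
        rw [← ENNReal.coe_pow, ← ENNReal.coe_mul, ← ENNReal.ofReal_coe_nnreal]
        push_cast
        rfl
  · intro 𝒟 _ h𝒟
    refine ⟨fun h => eq_map_of_distApply_eq hsum hq' hq1' hlt hratio hα hμs hmass hlim h𝒟 h, ?_⟩
    -- Conversely, applying `𝒮` to the law of `μ*` gives the law of `𝐒μ*`, and `𝐒μ* = μ*` almost
    -- surely.
    rintro rfl
    rw [← map_treeApply 𝒮 hμs]
    exact Measure.map_congr hfix
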